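/- Let $d\ge 1$ be an integer and let $T_d\in\mathbb R[z]$ be the Chebyshev polynomial of degree $d$, $T_d(\cos\theta)=\cos(d\theta)$. For a real polynomial $f(x,y)$ of (total) degree $d$, let $S_{d,f}$ be the real algebraic surface of degree $d$ in $\mathbb RP^3$ that is the projective closure of the affine surface $f(x,y)-T_d(z)=0$; these are the surfaces constructed by (the real version of) Chmutov's method. A solitary point of a real surface $F=0$ in $\mathbb RP^3$, $F$ homogeneous, is an ordinary double point ($F$ and all its partial derivatives vanish there and the $4\times4$ Hessian matrix of $F$ has rank $3$) of the type $x^2+y^2+z^2=0$, i.e. one at which the Hessian is semidefinite. Each $S_{d,f}$ has only finitely many solitary points, and there is a largest number $\mu_{Ch}(d)$ of solitary points among the surfaces $S_{d,f}$ with $\deg f=d$. It satisfies $$\mu_{Ch}(d)=\tfrac14 d^3+o(d^3)\qquad(d\to\infty).$$ Moreover, put $L(d)=\frac{(d-1)(d-2)^2}{4}$ for even $d$ and $L(d)=\frac{(d-1)^2(d-2)}{4}$ for odd $d$. Then there are real polynomials $f_d(x,y)$ of degree $d$ $(d\ge1)$ such that the number $N(d)$ of solitary points of $S_{d,f_d}$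 satisfies $N(d)\ge L(d)$ for all $d\ge 1$, and this family is asymptotically optimal for Chmutov's method: $N(d)\sim\mu_{Ch}(d)$ as $d\to\infty$. -/

import Mathlib

open Filter Asymptotics

noncomputable section

namespace Chmutov

/-- Homogenization to degree `d` of a polynomial `g` of degree at most `d` in three variables:
the terms of degree `i` are multiplied by the power `d - i` of the new (last) variable. -/
def homogenize (d : ℕ) (g : MvPolynomial (Fin 3) ℝ) : MvPolynomial (Fin 4) ℝ :=
  ∑ i ∈ Finset.range (d + 1),
    MvPolynomial.rename Fin.castSucc (MvPolynomial.homogeneousComponent i g) *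
      MvPolynomial.X (Fin.last 3) ^ (d - i)

/-- The Hessian matrix of `F` at `v`. -/
def hessian (F : MvPolynomial (Fin 4) ℝ) (v : Fin 4 → ℝ) : Matrix (Fin 4) (Fin 4) ℝ :=
  Matrix.of fun i j =>
    MvPolynomial.eval v (MvPolynomial.pderiv i (MvPolynomial.pderiv j F))

/-- The surface `F = 0` has an ordinary double point at the point with homogeneous
coordinates `v`: `F` and its partial derivatives vanish there and the Hessian has rank `3`. -/
def IsOrdinaryDoublePoint (F : MvPolynomial (Fin 4) ℝ) (v : Fin 4 → ℝ) : Prop :=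
  MvPolynomial.eval v F = 0 ∧
  (∀ i, MvPolynomial.eval v (MvPolynomial.pderiv i F) = 0) ∧
  (hessian F v).rank = 3

/-- Solitary points are the ordinary double points of type `x ^ 2 + y ^ 2 + z ^ 2 = 0`: the
quadratic form of rank `3` given by the Hessian is semidefinite (of either sign, since `F` and
`-F` define the same surface); the other real type, `x ^ 2 + y ^ 2 - z ^ 2 = 0`, is the
indefinite one. -/
def IsSolitary (F : MvPolynomial (Fin 4) ℝ) (v : Fin 4 → ℝ) : Prop :=
  IsOrdinaryDoublePoint F v ∧ ((hessian F v).PosSemidef ∨ (-(hessian F v)).PosSemidef)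

/-- The set of solitary points in the real projective space of the surface defined by the
homogeneous polynomial `F` (for such `F` the condition does not depend on the chosen
representative of `p`). -/
def solitaryPoints (F : MvPolynomial (Fin 4) ℝ) : Set (Projectivization ℝ (Fin 4 → ℝ)) :=
  {p | IsSolitary F p.rep}

/-- The polynomial `f(x, y) - T_d(z)`, with `T_d` the Chebyshev polynomial of degree `d`. -/
def affineEquation (d : ℕ) (f : MvPolynomial (Fin 2) ℝ) : MvPolynomial (Fin 3) ℝ :=
  MvPolynomial.rename Fin.castSucc f -
    Polynomial.aeval (MvPolynomial.X (Fin.last 2) : MvPolynomial (Fin 3) ℝ)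
      (Polynomial.Chebyshev.T ℝ (d : ℤ))

/-- The homogeneous equation of the projective closure of the surface `f(x, y) = T_d(z)`. -/
def equation (d : ℕ) (f : MvPolynomial (Fin 2) ℝ) : MvPolynomial (Fin 4) ℝ :=
  homogenize d (affineEquation d f)

/-- The numbers of solitary points on the projective surfaces of degree `d` given by
`f(x, y) = T_d(z)`, where `f` runs through the real polynomials of degree `d`. -/
def solitaryCounts (d : ℕ) : Set ℕ :=
  {n | ∃ f : MvPolynomial (Fin 2) ℝ, f.totalDegree = d ∧
    n = (solitaryPoints (equation d f)).ncard}

/-- The largest number of solitary points on a surface of degree `d` obtained by Chmutov's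
method. -/
def muCh (d : ℕ) : ℕ := sSup (solitaryCounts d)

/-- `(d-1)(d-2)^2/4` for even `d` and `(d-1)^2(d-2)/4` for odd `d`. -/
def lowerBound (d : ℕ) : ℝ :=
  if Even d then ((d : ℝ) - 1) * ((d : ℝ) - 2) ^ 2 / 4
  else ((d : ℝ) - 1) ^ 2 * ((d : ℝ) - 2) / 4

end Chmutov

end

namespace Chmutov
open MvPolynomial Topology Matrix

/-! Upper bound. For `d ≥ 3` every solitary point is affine. At `(q, z)` the Hessian in the affine
directions is Hess f ⊕ (-T_d''), so semidefiniteness and rank `3` force `q` to be a nondegenerate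
local extremum of `f` and `z` a double root of T_d - f(q). Each `q` allows at most d/2 such `z`, and
there are at most d(d+1)/2 such `q` (`card_extrema_le`), which gives d²(d+1)/4.

The bound on extrema is of Petrovskii–Oleinik type. Adding δ(x^(d+1) + y^(d+1)) makes the gradient,
up to scaling, a system x^d + l₁ = y^d + l₂ = 0 without zeros at infinity, and extrema become zeros
with positive Jacobian. On the quotient algebra consider the residue form, which reads off the
coefficient of x^(d-1)y^(d-1) of a product. It is positive definite on the span of classes attached
to those zeros (`exists_delta`), while classes of degree at most d-2 are isotropic by Euler–Jacobi
(`coeff_corner_of_mem_ideal`). The isotropic space has codimension d(d+1)/2, so there are no more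
zeros than that (`card_common_zeros_le`).

Lower bound. The curve parametrized by s ↦ (s^d, (s-1)^d) has degree `d`. Each conjugate pair t, t̄
with t^d and (t-1)^d real gives a solitary node, and (d-1)(d-2)/2 of these are used. Its equation
`powerCurve d` has an extremum with value `0` at each node (`mem_extrema_powerCurve`). Polynomials
of degree below d-2 interpolate arbitrary values at the nodes (`exists_interpolation`), so a small
perturbation followed by rescaling gives all nearby minima the value `1` and all maxima the value
`-1` (`exists_extrema_with_unit_values`). Since T_d has at least ⌊(d-1)/2⌋ maxima at level `1` and
as many minima at level `-1`, the surface has at least L(d) solitary points. Both bounds are d³/4 +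
O(d²), which yields all the asymptotics. -/

/-! ### Euler–Jacobi vanishing and zeros with positive Jacobian. -/

theorem isHomogeneous_eq_zero_of_totalDegree_lt {σ : Type*} {h : MvPolynomial σ ℝ} {k : ℕ}
    (hh : h.IsHomogeneous k) (hk : h.totalDegree < k) : h = 0 := by
  by_contra h0
  exact absurd (hh.totalDegree h0) hk.ne

theorem totalDegree_sub_homogeneousComponent_lt {σ : Type*} {a : MvPolynomial σ ℝ} {m : ℕ}
    (hm : 0 < m) (ha : a.totalDegree ≤ m) :
    (a - homogeneousComponent m a).totalDegree < m := by
  rw [totalDegree, Finset.sup_lt_iff (by simpa using hm)]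
  intro s hs
  rw [mem_support_iff, coeff_sub, coeff_homogeneousComponent] at hs
  by_contra hlt
  push Not at hlt
  split_ifs at hs with h
  · simp at hs
  · rw [sub_zero] at hs
    have h1 := le_totalDegree (mem_support_iff.2 hs)
    have h2 : s.degree = s.sum fun _ e => e := rfl
    omega

/-- Exponent `(i, j)`. -/
noncomputable def expo (i j : ℕ) : Fin 2 →₀ ℕ := Finsupp.single 0 i + Finsupp.single 1 j

@[simp] theorem expo_zero (i j : ℕ) : expo i j 0 = i := by simp [expo]
@[simp] theorem expo_one (i j : ℕ) : expo i j 1 = j := by simp [expo]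

theorem sum_fin_two (s : Fin 2 →₀ ℕ) : (s.sum fun _ e => e) = s 0 + s 1 := by
  rw [Finsupp.sum_fintype _ _ (by simp)]; simp

theorem eq_expo (s : Fin 2 →₀ ℕ) : s = expo (s 0) (s 1) := by
  ext i; fin_cases i <;> simp

theorem coeff_eq_zero_of_totalDegree_lt_add {h : MvPolynomial (Fin 2) ℝ} {i j : ℕ}
    (hh : h.totalDegree < i + j) : coeff (expo i j) h = 0 := by
  by_contra h0
  have := le_totalDegree (mem_support_iff.2 h0)
  rw [sum_fin_two] at this
  simp at this; omega

theorem coeff_mul_X_zero_pow_of_lt (a : MvPolynomial (Fin 2) ℝ) {n i j : ℕ} (h : i < n) :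
    coeff (expo i j) (a * X 0 ^ n) = 0 := by
  rw [X_pow_eq_monomial, coeff_mul_monomial', if_neg]
  intro hle
  have := hle 0
  simp at this; omega

theorem coeff_mul_X_one_pow_of_lt (a : MvPolynomial (Fin 2) ℝ) {n i j : ℕ} (h : j < n) :
    coeff (expo i j) (a * X 1 ^ n) = 0 := by
  rw [X_pow_eq_monomial, coeff_mul_monomial', if_neg]
  intro hle
  have := hle 1
  simp at this; omega

/-- The Euler–Jacobi theorem in algebraic form. If the cofactors have degree `m > n - 2`, the part
of degree `m + n` must cancel, so the leading forms satisfy A x^n + B y^n = 0 and are a multiple `q`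
of the Koszul syzygy (y^n, -x^n). Subtracting `q` times the syzygy of the two generators lowers `m`.
Once `m ≤ n - 2`, no term of the sum can hit the corner exponent. -/
theorem coeff_corner_of_mem_ideal {n : ℕ} (hn : 2 ≤ n) {l₁ l₂ : MvPolynomial (Fin 2) ℝ}
    (h₁ : l₁.totalDegree < n) (h₂ : l₂.totalDegree < n) (m : ℕ) :
    ∀ a b : MvPolynomial (Fin 2) ℝ, a.totalDegree ≤ m → b.totalDegree ≤ m →
      (a * (X 0 ^ n + l₁) + b * (X 1 ^ n + l₂)).totalDegree ≤ 2 * n - 2 →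
      coeff (expo (n - 1) (n - 1)) (a * (X 0 ^ n + l₁) + b * (X 1 ^ n + l₂)) = 0 := by
  induction m using Nat.strong_induction_on with
  | _ m ih =>
  intro a b ha hb hdeg
  have hal := totalDegree_mul a l₁
  have hbl := totalDegree_mul b l₂
  by_cases hm : m + 2 ≤ n
  · rw [mul_add, mul_add, coeff_add, coeff_add, coeff_add,
      coeff_mul_X_zero_pow_of_lt _ (by omega), coeff_mul_X_one_pow_of_lt _ (by omega),
      coeff_eq_zero_of_totalDegree_lt_add (h := a * l₁) (by omega),
      coeff_eq_zero_of_totalDegree_lt_add (h := b * l₂) (by omega)]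
    simp
  · set A := homogeneousComponent m a with hA
    set B := homogeneousComponent m b with hB
    have hm0 : 0 < m := by omega
    have ha' := totalDegree_sub_homogeneousComponent_lt hm0 ha
    have hb' := totalDegree_sub_homogeneousComponent_lt hm0 hb
    rw [← hA] at ha'
    rw [← hB] at hb'
    have hX0 : (X 0 ^ n : MvPolynomial (Fin 2) ℝ).totalDegree = n := totalDegree_X_pow _ _
    have hX1 : (X 1 ^ n : MvPolynomial (Fin 2) ℝ).totalDegree = n := totalDegree_X_pow _ _
    have htop : A * X 0 ^ n + B * X 1 ^ n = 0 := by
      apply isHomogeneous_eq_zero_of_totalDegree_lt (k := m + n)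
      · have e0 : (X 0 ^ n : MvPolynomial (Fin 2) ℝ).IsHomogeneous n := isHomogeneous_X_pow _ _
        have e1 : (X 1 ^ n : MvPolynomial (Fin 2) ℝ).IsHomogeneous n := isHomogeneous_X_pow _ _
        exact ((homogeneousComponent_isHomogeneous m a).mul e0).add
          ((homogeneousComponent_isHomogeneous m b).mul e1)
      · have : A * X 0 ^ n + B * X 1 ^ n =
            (a * (X 0 ^ n + l₁) + b * (X 1 ^ n + l₂)) - (a - A) * X 0 ^ n - (b - B) * X 1 ^ n
              - a * l₁ - b * l₂ := by ring
        rw [this]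
        have t1 := totalDegree_mul (a - A) (X 0 ^ n)
        have t2 := totalDegree_mul (b - B) (X 1 ^ n)
        rw [hX0] at t1
        rw [hX1] at t2
        refine (totalDegree_sub _ _).trans_lt (max_lt ((totalDegree_sub _ _).trans_lt (max_lt
          ((totalDegree_sub _ _).trans_lt (max_lt ((totalDegree_sub _ _).trans_lt
            (max_lt ?_ ?_)) ?_)) ?_)) ?_) <;> omega
    have hdvd : (X 1 : MvPolynomial (Fin 2) ℝ) ^ n ∣ A := by
      have hp : Prime (X 1 : MvPolynomial (Fin 2) ℝ) := X_prime
      have hnd : ¬ (X 1 : MvPolynomial (Fin 2) ℝ) ∣ X 0 ^ n := by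
        intro h
        have := hp.dvd_of_dvd_pow h
        rw [X_dvd_X] at this
        simp at this
      refine hp.pow_dvd_of_dvd_mul_right n hnd ⟨-B, ?_⟩
      linear_combination htop
    obtain ⟨q, hq⟩ := hdvd
    have hBq : B = - (X 0 ^ n * q) := by
      have : (X 1 : MvPolynomial (Fin 2) ℝ) ^ n ≠ 0 := pow_ne_zero _ (X_ne_zero _)
      apply mul_left_cancel₀ this
      linear_combination htop - X 0 ^ n * hq
    have hqdeg : ∀ l : MvPolynomial (Fin 2) ℝ, l.totalDegree < n → (q * l).totalDegree < m := by
      intro l hl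
      by_cases hq0 : q = 0
      · simpa [hq0] using hm0
      have h1 : A.totalDegree = n + q.totalDegree := by
        rw [hq, totalDegree_mul_of_isDomain (pow_ne_zero _ (X_ne_zero _)) hq0, hX1]
      have h2 : A.totalDegree ≤ m := (homogeneousComponent_isHomogeneous m a).totalDegree_le
      have := totalDegree_mul q l
      omega
    have key := ih (m - 1) (by omega) (a - q * (X 1 ^ n + l₂)) (b + q * (X 0 ^ n + l₁)) ?_ ?_ ?_
    · rwa [show (a - q * (X 1 ^ n + l₂)) * (X 0 ^ n + l₁) + (b + q * (X 0 ^ n + l₁)) *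
        (X 1 ^ n + l₂) = a * (X 0 ^ n + l₁) + b * (X 1 ^ n + l₂) by ring] at key
    · rw [show a - q * (X 1 ^ n + l₂) = (a - A) - q * l₂ by rw [hq]; ring]
      have := totalDegree_sub (a - A) (q * l₂)
      have := hqdeg _ h₂
      have := max_lt ha' this
      omega
    · rw [show b + q * (X 0 ^ n + l₁) = (b - B) + q * l₁ by rw [hBq]; ring]
      have := totalDegree_add (b - B) (q * l₁)
      have := hqdeg _ h₁
      have := max_lt hb' this
      omega
    · rwa [show (a - q * (X 1 ^ n + l₂)) * (X 0 ^ n + l₁) + (b + q * (X 0 ^ n + l₁)) *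
        (X 1 ^ n + l₂) = a * (X 0 ^ n + l₁) + b * (X 1 ^ n + l₂) by ring]

/-- Every polynomial is congruent modulo `(x ^ n + l₁, y ^ n + l₂)` to one of degree less than `n`
in each variable. -/
theorem exists_reduced {n : ℕ} {l₁ l₂ : MvPolynomial (Fin 2) ℝ}
    (h₁ : l₁.totalDegree < n) (h₂ : l₂.totalDegree < n) (h : MvPolynomial (Fin 2) ℝ) :
    ∃ r : MvPolynomial (Fin 2) ℝ, (∀ s ∈ r.support, s 0 < n ∧ s 1 < n) ∧
      h - r ∈ Ideal.span {X 0 ^ n + l₁, X 1 ^ n + l₂} := by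
  set I : Ideal (MvPolynomial (Fin 2) ℝ) := Ideal.span {X 0 ^ n + l₁, X 1 ^ n + l₂} with hI
  have hg1 : X 0 ^ n + l₁ ∈ I := Ideal.subset_span (by simp)
  have hg2 : X 1 ^ n + l₂ ∈ I := Ideal.subset_span (by simp)
  let P : MvPolynomial (Fin 2) ℝ → Prop := fun h =>
    ∃ r : MvPolynomial (Fin 2) ℝ, (∀ s ∈ r.support, s 0 < n ∧ s 1 < n) ∧ h - r ∈ I
  have hadd : ∀ a b, P a → P b → P (a + b) := by
    rintro a b ⟨r, hr, hr'⟩ ⟨t, ht, ht'⟩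
    refine ⟨r + t, fun s hs => ?_, by
      rw [show a + b - (r + t) = (a - r) + (b - t) by ring]; exact I.add_mem hr' ht'⟩
    rcases Finset.mem_union.1 (support_add hs) with h | h
    exacts [hr s h, ht s h]
  have hzero : P 0 := ⟨0, by simp, by simp⟩
  have hsmul : ∀ (c : ℝ) a, P a → P (C c * a) := by
    rintro c a ⟨r, hr, hr'⟩
    refine ⟨C c * r, fun s hs => hr s ?_, by rw [← mul_sub]; exact I.mul_mem_left _ hr'⟩
    rw [mem_support_iff, coeff_C_mul] at hs
    exact mem_support_iff.2 (right_ne_zero_of_mul hs)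
  have hmod : ∀ a b, a - b ∈ I → P b → P a := by
    rintro a b hab ⟨r, hr, hr'⟩
    exact ⟨r, hr, by rw [show a - r = (a - b) + (b - r) by ring]; exact I.add_mem hab hr'⟩
  have hsum : ∀ a : MvPolynomial (Fin 2) ℝ, (∀ s ∈ a.support, P (monomial s 1)) → P a := by
    intro a ha
    rw [a.as_sum]
    refine Finset.sum_induction _ P hadd hzero fun s hs => ?_
    have := hsmul (coeff s a) _ (ha s hs)
    rwa [C_mul_monomial, mul_one] at this
  -- Replacing x^n by `-l₁` or y^n by `-l₂` strictly lowers the total degree, so the rewriting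
  -- terminates.
  have hmon : ∀ k, ∀ s : Fin 2 →₀ ℕ, s 0 + s 1 = k → P (monomial s 1) := by
    intro k
    induction k using Nat.strong_induction_on with
    | _ k ih =>
    intro s hs
    have hlow : ∀ (a l : MvPolynomial (Fin 2) ℝ), a.totalDegree + n ≤ k → l.totalDegree < n →
        P (-(a * l)) := by
      intro a l ha hl
      apply hsum
      intro t ht
      have h1 := le_totalDegree ht
      rw [totalDegree_neg, sum_fin_two] at h1
      have h2 := totalDegree_mul a l
      exact ih (t 0 + t 1) (by omega) t rfl
    by_cases h0 : n ≤ s 0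
    · refine hmod _ (-(monomial (expo (s 0 - n) (s 1)) 1 * l₁)) ?_ (hlow _ _ ?_ h₁)
      · have : monomial s (1 : ℝ) = monomial (expo (s 0 - n) (s 1)) 1 * X 0 ^ n := by
          rw [X_pow_eq_monomial, monomial_mul, one_mul]
          refine congrArg (fun t => monomial t (1 : ℝ)) ?_
          ext i; fin_cases i <;> simp [h0]
        rw [this, sub_neg_eq_add, ← mul_add]
        exact I.mul_mem_left _ hg1
      · rw [totalDegree_monomial _ one_ne_zero, sum_fin_two]; simp; omega
    by_cases h1 : n ≤ s 1
    · refine hmod _ (-(monomial (expo (s 0) (s 1 - n)) 1 * l₂)) ?_ (hlow _ _ ?_ h₂)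
      · have : monomial s (1 : ℝ) = monomial (expo (s 0) (s 1 - n)) 1 * X 1 ^ n := by
          rw [X_pow_eq_monomial, monomial_mul, one_mul]
          refine congrArg (fun t => monomial t (1 : ℝ)) ?_
          ext i; fin_cases i <;> simp [h1]
        rw [this, sub_neg_eq_add, ← mul_add]
        exact I.mul_mem_left _ hg2
      · rw [totalDegree_monomial _ one_ne_zero, sum_fin_two]; simp; omega
    · refine ⟨monomial s 1, fun t ht => ?_, by simp⟩
      have := support_monomial_subset ht
      rw [Finset.mem_singleton] at this
      subst this; omega
  exact hsum h fun s _ => hmon _ s rfl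

/-- First-order expansion at a point, with degree bounds. -/
theorem exists_sub_eval_eq (p : Fin 2 → ℝ) {k : ℕ} (l : MvPolynomial (Fin 2) ℝ)
    (hl : l.totalDegree ≤ k + 1) : ∃ u v : MvPolynomial (Fin 2) ℝ,
      u.totalDegree ≤ k ∧ v.totalDegree ≤ k ∧
      l - C (eval p l) = (X 0 - C (p 0)) * u + (X 1 - C (p 1)) * v := by
  let P : MvPolynomial (Fin 2) ℝ → Prop := fun l =>
    ∃ u v : MvPolynomial (Fin 2) ℝ, u.totalDegree ≤ k ∧ v.totalDegree ≤ k ∧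
      l - C (eval p l) = (X 0 - C (p 0)) * u + (X 1 - C (p 1)) * v
  have hadd : ∀ a b, P a → P b → P (a + b) := by
    rintro a b ⟨u, v, hu, hv, h⟩ ⟨u', v', hu', hv', h'⟩
    refine ⟨u + u', v + v', (totalDegree_add _ _).trans (max_le hu hu'),
      (totalDegree_add _ _).trans (max_le hv hv'), ?_⟩
    rw [map_add, C_add]; linear_combination h + h'
  have hsmul : ∀ (c : ℝ) a, P a → P (C c * a) := by
    rintro c a ⟨u, v, hu, hv, h⟩
    have hc : ∀ w : MvPolynomial (Fin 2) ℝ, w.totalDegree ≤ k → (C c * w).totalDegree ≤ k := by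
      intro w hw
      have := totalDegree_mul (C c) w
      rw [totalDegree_C] at this; omega
    refine ⟨C c * u, C c * v, hc u hu, hc v hv, ?_⟩
    rw [map_mul, eval_C, C_mul]; linear_combination C c * h
  have hmon : ∀ m ≤ k + 1, ∀ s : Fin 2 →₀ ℕ, s 0 + s 1 = m →
      P (monomial s 1) := by
    intro m
    induction m with
    | zero =>
      intro _ s hs
      have : s = 0 := by ext i; fin_cases i <;> simp <;> omega
      subst this
      exact ⟨0, 0, by simp, by simp, by simp⟩
    | succ m ih =>
      intro hm s hs
      have hstep : ∀ (i : Fin 2) (t : Fin 2 →₀ ℕ), t 0 + t 1 = m →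
          monomial s (1 : ℝ) = X i * monomial t 1 → P (monomial s 1) := by
        intro i t ht hst
        obtain ⟨u, v, hu, hv, h⟩ := ih (by omega) t ht
        have hdeg : (monomial t (1 : ℝ)).totalDegree ≤ k := by
          rw [totalDegree_monomial _ one_ne_zero, sum_fin_two]; omega
        have hC : ∀ (c : ℝ) (w : MvPolynomial (Fin 2) ℝ), w.totalDegree ≤ k →
            (C c * w).totalDegree ≤ k := by
          intro c w hw
          have := totalDegree_mul (C c) w
          rw [totalDegree_C] at this; omega
        rw [hst]
        fin_cases i
        · refine ⟨monomial t 1 + C (p 0) * u, C (p 0) * v,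
            (totalDegree_add _ _).trans (max_le hdeg (hC _ _ hu)), hC _ _ hv, ?_⟩
          simp only [map_mul, eval_X, Fin.zero_eta]
          linear_combination C (p 0) * h
        · refine ⟨C (p 1) * u, monomial t 1 + C (p 1) * v, hC _ _ hu,
            (totalDegree_add _ _).trans (max_le hdeg (hC _ _ hv)), ?_⟩
          simp only [map_mul, eval_X, Fin.mk_one]
          linear_combination C (p 1) * h
      by_cases h0 : s 0 = 0
      · refine hstep 1 (expo (s 0) (s 1 - 1)) (by simp; omega) ?_
        rw [X, monomial_mul, one_mul]
        refine congrArg (fun t => monomial t (1 : ℝ)) ?_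
        ext i; fin_cases i <;> simp; omega
      · refine hstep 0 (expo (s 0 - 1) (s 1)) (by simp; omega) ?_
        rw [X, monomial_mul, one_mul]
        refine congrArg (fun t => monomial t (1 : ℝ)) ?_
        ext i; fin_cases i <;> simp; omega
  change P l
  rw [l.as_sum]
  refine Finset.sum_induction _ P hadd ⟨0, 0, by simp, by simp, by simp⟩ fun s hs => ?_
  have h1 := le_totalDegree hs
  rw [sum_fin_two] at h1
  have := hsmul (coeff s l) _ (hmon _ (h1.trans hl) s rfl)
  rwa [C_mul_monomial, mul_one] at this

theorem exists_X_pow_sub_eq (i : Fin 2) (c : ℝ) (n : ℕ) : ∃ w : MvPolynomial (Fin 2) ℝ,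
    w.totalDegree ≤ n ∧ X i ^ (n + 2) - C (c ^ (n + 2)) = (X i - C c) * (X i ^ (n + 1) + w) := by
  induction n with
  | zero => exact ⟨C c, by simp, by simp only [C_pow]; ring⟩
  | succ n ih =>
    obtain ⟨w, hw, h⟩ := ih
    refine ⟨C c * (X i ^ (n + 1) + w), ?_, ?_⟩
    · refine (totalDegree_mul _ _).trans ?_
      rw [totalDegree_C, zero_add]
      refine (totalDegree_add _ _).trans (max_le ?_ (by omega))
      rw [totalDegree_X_pow]
    · rw [pow_succ c, C_mul]
      linear_combination C c * h

/-- The bordered Jacobian determinant: it is annihilated by the maximal ideal of `p` modulo the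
ideal of `x ^ n + l₁`, `y ^ n + l₂`. -/
theorem exists_delta {n : ℕ} (hn : 2 ≤ n) {l₁ l₂ : MvPolynomial (Fin 2) ℝ}
    (h₁ : l₁.totalDegree < n) (h₂ : l₂.totalDegree < n) {p : Fin 2 → ℝ}
    (hp₁ : eval p (X 0 ^ n + l₁) = 0) (hp₂ : eval p (X 1 ^ n + l₂) = 0) :
    ∃ D : MvPolynomial (Fin 2) ℝ, D.totalDegree ≤ 2 * n - 2 ∧
      coeff (expo (n - 1) (n - 1)) D = 1 ∧
      eval p D = eval p (pderiv 0 (X 0 ^ n + l₁)) * eval p (pderiv 1 (X 1 ^ n + l₂)) -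
        eval p (pderiv 1 (X 0 ^ n + l₁)) * eval p (pderiv 0 (X 1 ^ n + l₂)) ∧
      ∀ h : MvPolynomial (Fin 2) ℝ,
        h * D - C (eval p h) * D ∈ Ideal.span {X 0 ^ n + l₁, X 1 ^ n + l₂} := by
  obtain ⟨k, rfl⟩ : ∃ k, n = k + 2 := ⟨n - 2, by omega⟩
  obtain ⟨u₁, v₁, hu₁, hv₁, e₁⟩ := exists_sub_eval_eq p (k := k) l₁ (by omega)
  obtain ⟨u₂, v₂, hu₂, hv₂, e₂⟩ := exists_sub_eval_eq p (k := k) l₂ (by omega)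
  obtain ⟨w₁, hw₁, f₁⟩ := exists_X_pow_sub_eq 0 (p 0) k
  obtain ⟨w₂, hw₂, f₂⟩ := exists_X_pow_sub_eq 1 (p 1) k
  set g₁ : MvPolynomial (Fin 2) ℝ := X 0 ^ (k + 2) + l₁ with hg₁
  set g₂ : MvPolynomial (Fin 2) ℝ := X 1 ^ (k + 2) + l₂ with hg₂
  -- Both generators are written as combinations of x - p₀ and y - p₁. The determinant of the
  -- cofactor matrix is the required `D`: by Cramer's rule (x - p₀)D and (y - p₁)D lie in the ideal,
  -- and at `p` it equals the Jacobian.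
  have G₁ : g₁ = (X 0 - C (p 0)) * (X 0 ^ (k + 1) + (w₁ + u₁)) + (X 1 - C (p 1)) * v₁ := by
    have : C (p 0 ^ (k + 2)) + C (eval p l₁) = (0 : MvPolynomial (Fin 2) ℝ) := by
      rw [← C_add]; simp [hg₁] at hp₁; simp [hp₁]
    linear_combination e₁ + f₁ + this
  have G₂ : g₂ = (X 0 - C (p 0)) * u₂ + (X 1 - C (p 1)) * (X 1 ^ (k + 1) + (w₂ + v₂)) := by
    have : C (p 1 ^ (k + 2)) + C (eval p l₂) = (0 : MvPolynomial (Fin 2) ℝ) := by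
      rw [← C_add]; simp [hg₂] at hp₂; simp [hp₂]
    linear_combination e₂ + f₂ + this
  have dU : (w₁ + u₁).totalDegree ≤ k := (totalDegree_add _ _).trans (max_le hw₁ hu₁)
  have dV : (w₂ + v₂).totalDegree ≤ k := (totalDegree_add _ _).trans (max_le hw₂ hv₂)
  generalize w₁ + u₁ = U at G₁ dU
  generalize w₂ + v₂ = V at G₂ dV
  have dlow : (X 0 ^ (k + 1) * V + U * X 1 ^ (k + 1) + U * V - v₁ * u₂).totalDegree
      ≤ 2 * k + 1 := by
    have t0 : (X 0 ^ (k + 1) : MvPolynomial (Fin 2) ℝ).totalDegree = k + 1 := totalDegree_X_pow _ _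
    have t1 : (X 1 ^ (k + 1) : MvPolynomial (Fin 2) ℝ).totalDegree = k + 1 := totalDegree_X_pow _ _
    have m1 := totalDegree_mul (X 0 ^ (k + 1)) V
    have m2 := totalDegree_mul U (X 1 ^ (k + 1))
    have m3 := totalDegree_mul U V
    have m4 := totalDegree_mul v₁ u₂
    refine (totalDegree_sub _ _).trans (max_le ((totalDegree_add _ _).trans (max_le
      ((totalDegree_add _ _).trans (max_le ?_ ?_)) ?_)) ?_) <;> omega
  have hD : (X 0 ^ (k + 1) + U) * (X 1 ^ (k + 1) + V) - v₁ * u₂ =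
      monomial (expo (k + 1) (k + 1)) 1 +
        (X 0 ^ (k + 1) * V + U * X 1 ^ (k + 1) + U * V - v₁ * u₂) := by
    have : monomial (expo (k + 1) (k + 1)) (1 : ℝ) = X 0 ^ (k + 1) * X 1 ^ (k + 1) := by
      rw [X_pow_eq_monomial, X_pow_eq_monomial, monomial_mul, one_mul, expo]
    rw [this]; ring
  have hI₁ : g₁ ∈ Ideal.span {g₁, g₂} := Ideal.subset_span (by simp)
  have hI₂ : g₂ ∈ Ideal.span {g₁, g₂} := Ideal.subset_span (by simp)
  refine ⟨(X 0 ^ (k + 1) + U) * (X 1 ^ (k + 1) + V) - v₁ * u₂, ?_, ?_, ?_, fun h => ?_⟩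
  · rw [hD]
    refine (totalDegree_add _ _).trans (max_le ?_ (by omega))
    rw [totalDegree_monomial _ one_ne_zero, sum_fin_two]; simp; omega
  · rw [hD, coeff_add, show k + 2 - 1 = k + 1 by omega, coeff_monomial, if_pos rfl,
      coeff_eq_zero_of_totalDegree_lt_add (by omega), add_zero]
  · rw [G₁, G₂]
    simp [Derivation.leibniz, pderiv_X]
  · obtain ⟨u, v, -, -, e⟩ := exists_sub_eval_eq p (k := h.totalDegree) h (by omega)
    have : h * ((X 0 ^ (k + 1) + U) * (X 1 ^ (k + 1) + V) - v₁ * u₂) -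
        C (eval p h) * ((X 0 ^ (k + 1) + U) * (X 1 ^ (k + 1) + V) - v₁ * u₂) =
        (u * (X 1 ^ (k + 1) + V) - v * u₂) * g₁ + (v * (X 0 ^ (k + 1) + U) - u * v₁) * g₂ := by
      rw [← sub_mul, e, G₁, G₂]; ring
    rw [this]
    exact Ideal.add_mem _ (Ideal.mul_mem_left _ _ hI₁) (Ideal.mul_mem_left _ _ hI₂)

theorem card_triangle (n : ℕ) : Fintype.card ((i : Fin n) × Fin (i + 1)) * 2 = n * (n + 1) := by
  rw [Fintype.card_sigma]
  simp only [Fintype.card_fin]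
  rw [Fin.sum_univ_eq_sum_range (fun i => i + 1) n]
  have := Finset.sum_range_id_mul_two (n + 1)
  rw [Finset.sum_range_succ'] at this
  simpa [mul_comm] using this

/-- The classes D_p satisfy D_p D_q ≡ 0 for p ≠ q and D_p² ≡ J(p) D_p, and each has corner
coefficient `1`. With too many zeros, some nontrivial combination Σ c_p D_p would be congruent to a
`v` of degree at most `n - 2`. Comparing corner coefficients in v² ≡ Σ c_p² J(p) D_p then gives Σ
c_p² J(p) = 0, contradicting J(p) > 0. -/
theorem card_common_zeros_le {n : ℕ} (hn : 2 ≤ n) {l₁ l₂ : MvPolynomial (Fin 2) ℝ}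
    (h₁ : l₁.totalDegree < n) (h₂ : l₂.totalDegree < n) (Z : Finset (Fin 2 → ℝ))
    (hZ : ∀ p ∈ Z, eval p (X 0 ^ n + l₁) = 0 ∧ eval p (X 1 ^ n + l₂) = 0 ∧
      0 < eval p (pderiv 0 (X 0 ^ n + l₁)) * eval p (pderiv 1 (X 1 ^ n + l₂)) -
        eval p (pderiv 1 (X 0 ^ n + l₁)) * eval p (pderiv 0 (X 1 ^ n + l₂))) :
    Z.card * 2 ≤ n * (n + 1) := by
  by_contra hcard
  push Not at hcard
  have hdelta := fun p : Z => exists_delta hn h₁ h₂ (hZ p p.2).1 (hZ p p.2).2.1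
  choose D hDdeg hDc hDp hDI using hdelta
  choose r hr hrI using fun p : Z => exists_reduced h₁ h₂ (D p)
  set I : Ideal (MvPolynomial (Fin 2) ℝ) := Ideal.span {X 0 ^ n + l₁, X 1 ^ n + l₂} with hI
  -- The index (i, a) with a ≤ i stands for the exponent (i, n-1-a). These are exactly the reduced
  -- exponents of total degree at least n-1, and there are n(n+1)/2 of them.
  let L : (Z → ℝ) →ₗ[ℝ] (((i : Fin n) × Fin (i + 1)) → ℝ) :=
    { toFun := fun c a => ∑ p, c p * coeff (expo (a.1 : ℕ) (n - 1 - a.2)) (r p)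
      map_add' := fun c c' => by ext a; simp [add_mul, Finset.sum_add_distrib]
      map_smul' := fun c c' => by ext a; simp [Finset.mul_sum, mul_assoc] }
  have hker : LinearMap.ker L ≠ ⊥ := by
    apply LinearMap.ker_ne_bot_of_finrank_lt
    rw [Module.finrank_fintype_fun_eq_card, Module.finrank_fintype_fun_eq_card, Fintype.card_coe]
    have := card_triangle n
    omega
  obtain ⟨c, hcL, hc0⟩ := (Submodule.ne_bot_iff _).1 hker
  have hc : ∀ i j, i < n → j < n → n ≤ i + j + 1 → ∑ p, c p * coeff (expo i j) (r p) = 0 := by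
    intro i j hi hj hij
    have := congrFun (LinearMap.mem_ker.1 hcL) ⟨⟨i, hi⟩, ⟨n - 1 - j, by simp; omega⟩⟩
    simpa [L, show n - 1 - (n - 1 - j) = j by omega] using this
  set v : MvPolynomial (Fin 2) ℝ := ∑ p, C (c p) * r p with hv
  set S : MvPolynomial (Fin 2) ℝ := ∑ p, C (c p) * D p with hS
  have hvdeg : v.totalDegree ≤ n - 2 := by
    refine Finset.sup_le fun s hs => ?_
    rw [sum_fin_two]
    have hs' : coeff s v ≠ 0 := mem_support_iff.1 hs
    rw [hv, coeff_sum] at hs'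
    simp only [coeff_C_mul] at hs'
    by_contra hlt
    obtain ⟨p, -, hp⟩ := Finset.exists_ne_zero_of_sum_ne_zero hs'
    have := hr p s (mem_support_iff.2 (right_ne_zero_of_mul hp))
    apply hs'
    rw [eq_expo s]
    exact hc _ _ this.1 this.2 (by omega)
  have hSv : S - v ∈ I := by
    rw [hS, hv, ← Finset.sum_sub_distrib]
    refine I.sum_mem fun p _ => ?_
    rw [← mul_sub]
    exact I.mul_mem_left _ (hrI p)
  set J : Z → ℝ := fun p => eval p.1 (D p) with hJ
  have hJpos : ∀ p, 0 < J p := fun p => by rw [hJ]; simp only [hDp]; exact (hZ p p.2).2.2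
  -- For a coordinate in which p and q differ, multiplying D_p D_q by it acts both as p_i and as q_i
  -- modulo the ideal.
  have hprod : ∀ p q : Z, p ≠ q → D p * D q ∈ I := by
    intro p q hpq
    obtain ⟨i, hi⟩ : ∃ i, p.1 i ≠ q.1 i := by
      by_contra! h
      exact hpq (Subtype.ext (funext h))
    have e1 := I.mul_mem_left (D q) (hDI p (X i))
    have e2 := I.mul_mem_left (D p) (hDI q (X i))
    have e3 := I.sub_mem e2 e1
    simp only [eval_X] at e3
    have e4 := I.mul_mem_left (C ((p.1 i - q.1 i)⁻¹)) e3
    have : C ((p.1 i - q.1 i)⁻¹) * (C (p.1 i) - C (q.1 i)) = (1 : MvPolynomial (Fin 2) ℝ) := by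
      rw [← C_sub, ← C_mul, inv_mul_cancel₀ (sub_ne_zero.2 hi), C_1]
    convert e4 using 1
    linear_combination (- D p * D q) * this
  have hsq : ∑ p, C (c p ^ 2 * J p) * D p - S * S ∈ I := by
    have hS2 : S * S = ∑ p, ∑ q, C (c p * c q) * (D p * D q) := by
      rw [hS, Finset.sum_mul_sum]
      refine Finset.sum_congr rfl fun p _ => Finset.sum_congr rfl fun q _ => ?_
      rw [C_mul]; ring
    rw [hS2, ← Finset.sum_sub_distrib]
    refine I.sum_mem fun p _ => ?_
    rw [← Finset.add_sum_erase _ _ (Finset.mem_univ p), ← sub_sub]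
    refine I.sub_mem ?_ (I.sum_mem fun q hq => I.mul_mem_left _ (hprod p q ?_))
    · have := I.mul_mem_left (-C (c p ^ 2)) (hDI p (D p))
      convert this using 1
      simp only [hJ, C_mul, C_pow]; ring
    · exact (Finset.ne_of_mem_erase hq).symm
  have hfin : ∑ p, C (c p ^ 2 * J p) * D p - v * v ∈ I := by
    have := I.add_mem hsq (I.mul_mem_left (S + v) hSv)
    convert this using 1; ring
  obtain ⟨a, b, hab⟩ := Ideal.mem_span_pair.1 hfin
  have hvv : (v * v).totalDegree ≤ 2 * n - 4 := (totalDegree_mul _ _).trans (by omega)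
  have hcor := coeff_corner_of_mem_ideal hn h₁ h₂ (max a.totalDegree b.totalDegree) a b
    (le_max_left _ _) (le_max_right _ _) (by
      rw [hab]
      refine (totalDegree_sub _ _).trans (max_le (totalDegree_finsetSum_le fun p _ => ?_)
        (by omega))
      refine (totalDegree_mul _ _).trans ?_
      rw [totalDegree_C, zero_add]
      exact hDdeg p)
  rw [hab, coeff_sub, coeff_eq_zero_of_totalDegree_lt_add (h := v * v) (by omega), sub_zero,
    coeff_sum] at hcor
  simp only [coeff_C_mul, hDc, mul_one] at hcor
  rw [Finset.sum_eq_zero_iff_of_nonneg fun p _ => mul_nonneg (sq_nonneg _) (hJpos p).le] at hcor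
  apply hc0
  ext p
  have := hcor p (Finset.mem_univ p)
  simpa [(hJpos p).ne'] using this

/-! ### Nondegenerate extrema in the plane and their number. -/

/-- The differential of a polynomial function. -/
noncomputable def evalDeriv {ι : Type*} [Fintype ι] (F : MvPolynomial ι ℝ) (v : ι → ℝ) :
    (ι → ℝ) →L[ℝ] ℝ :=
  ∑ i, eval v (pderiv i F) • ContinuousLinearMap.proj i

theorem evalDeriv_apply {ι : Type*} [Fintype ι] (F : MvPolynomial ι ℝ) (v w : ι → ℝ) :
    evalDeriv F v w = ∑ i, eval v (pderiv i F) * w i := by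
  simp [evalDeriv]

theorem hasStrictFDerivAt_eval {ι : Type*} [Fintype ι] (F : MvPolynomial ι ℝ) (v : ι → ℝ) :
    HasStrictFDerivAt (fun v => eval v F) (evalDeriv F v) v := by
  classical
  induction F using MvPolynomial.induction_on with
  | C a =>
    simp only [eval_C]
    refine (hasStrictFDerivAt_const a v).congr_fderiv ?_
    ext w; simp [evalDeriv_apply]
  | add p q hp hq =>
    simp only [map_add]
    refine (hp.add hq).congr_fderiv ?_
    ext w; simp [evalDeriv_apply, add_mul, Finset.sum_add_distrib]
  | mul_X p i hp =>
    simp only [map_mul, eval_X]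
    have hi : HasStrictFDerivAt (fun v : ι → ℝ => v i)
        (ContinuousLinearMap.proj (R := ℝ) (φ := fun _ : ι => ℝ) i) v :=
      (ContinuousLinearMap.proj (R := ℝ) (φ := fun _ : ι => ℝ) i).hasStrictFDerivAt
    refine (hp.mul hi).congr_fderiv ?_
    ext w
    simp [evalDeriv_apply, Derivation.leibniz, pderiv_X, Pi.single_apply, Finset.mul_sum, add_mul,
      Finset.sum_add_distrib, mul_assoc, apply_ite (eval v), ite_mul]

theorem hasStrictFDerivAt_family {κ : Type*} [Fintype κ] (f : MvPolynomial (Fin 2) ℝ)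
    (g : κ → MvPolynomial (Fin 2) ℝ) (p : Fin 2 → ℝ) :
    HasStrictFDerivAt
      (fun w : (κ → ℝ) × (Fin 2 → ℝ) => eval w.2 f + ∑ j, w.1 j * eval w.2 (g j))
      ((evalDeriv f p).comp (ContinuousLinearMap.snd ℝ _ _) +
        ∑ j, eval p (g j) • (ContinuousLinearMap.proj (R := ℝ) (φ := fun _ : κ => ℝ) j).comp
          (ContinuousLinearMap.fst ℝ _ _)) (0, p) := by
  have hs : ∀ F : MvPolynomial (Fin 2) ℝ,
      HasStrictFDerivAt (fun w : (κ → ℝ) × (Fin 2 → ℝ) => eval w.2 F)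
        ((evalDeriv F p).comp (ContinuousLinearMap.snd ℝ _ _)) (0, p) := fun F =>
    (hasStrictFDerivAt_eval F p).comp (0, p)
      (ContinuousLinearMap.snd ℝ (κ → ℝ) (Fin 2 → ℝ)).hasStrictFDerivAt
  have ht : ∀ j, HasStrictFDerivAt (fun w : (κ → ℝ) × (Fin 2 → ℝ) => w.1 j)
      ((ContinuousLinearMap.proj (R := ℝ) (φ := fun _ : κ => ℝ) j).comp
          (ContinuousLinearMap.fst ℝ _ (Fin 2 → ℝ))) (0, p) := fun j =>
    ((ContinuousLinearMap.proj (R := ℝ) (φ := fun _ : κ => ℝ) j).comp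
          (ContinuousLinearMap.fst ℝ _ (Fin 2 → ℝ))).hasStrictFDerivAt
  refine (hs f).add (HasStrictFDerivAt.fun_sum fun j _ => ?_)
  refine ((ht j).mul (hs (g j))).congr_fderiv ?_
  ext w <;> simp

theorem totalDegree_pderiv_le {σ : Type*} (i : σ) (f : MvPolynomial σ ℝ) :
    (pderiv i f).totalDegree ≤ f.totalDegree - 1 := by
  classical
  refine Finset.sup_le fun s hs => ?_
  rw [mem_support_iff, coeff_pderiv] at hs
  have := le_totalDegree (mem_support_iff.2 (left_ne_zero_of_mul hs))
  rw [Finsupp.sum_add_index' (by simp) (by simp), Finsupp.sum_single_index rfl] at this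
  omega

theorem pderiv_comm {σ : Type*} (i j : σ) (f : MvPolynomial σ ℝ) :
    pderiv i (pderiv j f) = pderiv j (pderiv i f) := by
  rcases eq_or_ne i j with rfl | hij
  · rfl
  ext m
  simp only [coeff_pderiv, Finsupp.add_apply, Finsupp.single_eq_of_ne hij,
    Finsupp.single_eq_of_ne hij.symm, add_zero]
  rw [add_right_comm]
  ring

/-- The Hessian determinant of a polynomial in two variables. -/
noncomputable def hess₂ (f : MvPolynomial (Fin 2) ℝ) : MvPolynomial (Fin 2) ℝ :=
  pderiv 0 (pderiv 0 f) * pderiv 1 (pderiv 1 f) - pderiv 1 (pderiv 0 f) * pderiv 0 (pderiv 1 f)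

/-- The nondegenerate local extrema of a polynomial in two variables. -/
def extrema (f : MvPolynomial (Fin 2) ℝ) : Set (Fin 2 → ℝ) :=
  {q | (∀ i, eval q (pderiv i f) = 0) ∧ 0 < eval q (hess₂ f)}

theorem surjective_hessian {f : MvPolynomial (Fin 2) ℝ} {p : Fin 2 → ℝ}
    (h : eval p (hess₂ f) ≠ 0) (y : Fin 2 → ℝ) :
    ∃ w : Fin 2 → ℝ, ∀ i, evalDeriv (pderiv i f) p w = y i := by
  simp only [hess₂, map_sub, map_mul] at h
  set a := eval p (pderiv 0 (pderiv 0 f))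
  set b := eval p (pderiv 1 (pderiv 0 f))
  set c := eval p (pderiv 0 (pderiv 1 f))
  set e := eval p (pderiv 1 (pderiv 1 f))
  refine ⟨![(e * y 0 - b * y 1) / (a * e - b * c), (a * y 1 - c * y 0) / (a * e - b * c)], ?_⟩
  intro i
  fin_cases i
  · simp only [Fin.zero_eta, evalDeriv_apply, Fin.sum_univ_two, Matrix.cons_val_zero,
      Matrix.cons_val_one]
    change a * _ + b * _ = _
    rw [mul_div_assoc', mul_div_assoc', ← add_div, div_eq_iff h]
    ring
  · simp only [Fin.mk_one, evalDeriv_apply, Fin.sum_univ_two, Matrix.cons_val_zero,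
      Matrix.cons_val_one]
    change c * _ + e * _ = _
    rw [mul_div_assoc', mul_div_assoc', ← add_div, div_eq_iff h]
    ring

/-- The map (δ, q) ↦ (δ, ∇(f + δG)(q)) has a surjective strict derivative at (0, p) because the
Hessian is invertible, so it sends neighbourhoods of (0, p) to neighbourhoods of (0, 0). Keeping δ
as a coordinate of the target lets every small δ be prescribed. -/
theorem exists_critical_near {f G : MvPolynomial (Fin 2) ℝ} {p : Fin 2 → ℝ}
    (hp : p ∈ extrema f) {U : Set (Fin 2 → ℝ)} (hU : U ∈ 𝓝 p) :
    ∀ᶠ δ in 𝓝 (0 : ℝ), ∃ q ∈ U, q ∈ extrema (f + C δ * G) := by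
  have hΨ := (ContinuousLinearMap.fst ℝ (Unit → ℝ) (Fin 2 → ℝ)).hasStrictFDerivAt
    (x := (0, p)) |>.prodMk (hasStrictFDerivAt_pi.2
      fun i => hasStrictFDerivAt_family (pderiv i f) (fun _ : Unit => pderiv i G) p)
  have hmap := hΨ.map_nhds_eq_of_surj (by
    rw [LinearMap.range_eq_top]
    rintro ⟨a, y⟩
    obtain ⟨w, hw⟩ := surjective_hessian hp.2.ne' (fun i => y i - a () * eval p (pderiv i G))
    refine ⟨(a, w), Prod.ext rfl (funext fun i => ?_)⟩
    have := hw i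
    simp [this, mul_comm])
  have hcont : Continuous fun w : (Unit → ℝ) × (Fin 2 → ℝ) =>
      eval w.2 (hess₂ (f + C (w.1 ()) * G)) := by
    simp only [hess₂, map_add, Derivation.leibniz, pderiv_C, smul_zero, add_zero, smul_eq_mul,
      map_mul, map_sub, eval_C]
    have : ∀ F : MvPolynomial (Fin 2) ℝ, Continuous fun w : (Unit → ℝ) × (Fin 2 → ℝ) =>
      eval w.2 F := fun F => (MvPolynomial.continuous_eval F).comp continuous_snd
    have h1 : Continuous fun w : (Unit → ℝ) × (Fin 2 → ℝ) => w.1 () := by fun_prop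
    fun_prop
  have hnhds : {w : (Unit → ℝ) × (Fin 2 → ℝ) | w.2 ∈ U ∧
      0 < eval w.2 (hess₂ (f + C (w.1 ()) * G))} ∈ 𝓝 ((0 : Unit → ℝ), p) := by
    refine Filter.inter_mem (continuous_snd.continuousAt.preimage_mem_nhds hU) ?_
    apply (isOpen_Ioi.preimage hcont).mem_nhds
    simpa using hp.2
  have himg := Filter.image_mem_map (m := fun w : (Unit → ℝ) × (Fin 2 → ℝ) => (w.1, fun i =>
    eval w.2 (pderiv i f) + ∑ j : Unit, w.1 j * eval w.2 (pderiv i G))) hnhds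
  erw [hmap] at himg
  have hpt : Filter.Tendsto (fun δ : ℝ => ((fun _ : Unit => δ), (0 : Fin 2 → ℝ))) (𝓝 0)
      (𝓝 ((0 : Unit → ℝ), fun i => eval p (pderiv i f) +
        ∑ j : Unit, (0 : Unit → ℝ) j * eval p (pderiv i G))) := by
    have : Continuous (fun δ : ℝ => ((fun _ : Unit => δ), (0 : Fin 2 → ℝ))) := by fun_prop
    convert this.tendsto 0 using 2
    ext i
    · rfl
    · simp [hp.1]
  filter_upwards [hpt himg] with δ hδ
  obtain ⟨⟨a, q⟩, ⟨hqU, hqJ⟩, hq⟩ := hδ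
  simp only [Prod.mk.injEq] at hq
  obtain ⟨rfl, hq⟩ := hq
  refine ⟨q, hqU, fun i => ?_, hqJ⟩
  simpa [Derivation.leibniz] using congrFun hq i

/-- A polynomial of degree at most `d` in two variables has at most `d (d + 1) / 2`
nondegenerate local extrema. -/
theorem card_extrema_le {d : ℕ} (hd : 2 ≤ d) {f : MvPolynomial (Fin 2) ℝ}
    (hf : f.totalDegree ≤ d) (Z : Finset (Fin 2 → ℝ)) (hZ : ∀ p ∈ Z, p ∈ extrema f) :
    Z.card * 2 ≤ d * (d + 1) := by
  -- Disjoint neighbourhoods keep the perturbed extrema distinct, so the perturbation loses none of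
  -- them.
  obtain ⟨U, hU, hdisj⟩ := Z.finite_toSet.t2_separation
  have hev : ∀ᶠ δ in 𝓝 (0 : ℝ), ∀ p ∈ Z,
      ∃ q ∈ U p, q ∈ extrema (f + C δ * (X 0 ^ (d + 1) + X 1 ^ (d + 1))) :=
    (Finset.eventually_all Z).2 fun p hp =>
      exists_critical_near (hZ p hp) ((hU p).2.mem_nhds (hU p).1)
  have hev' : ∀ᶠ δ in 𝓝[>] (0 : ℝ), 0 < δ ∧ ∀ p ∈ Z,
      ∃ q ∈ U p, q ∈ extrema (f + C δ * (X 0 ^ (d + 1) + X 1 ^ (d + 1))) :=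
    (eventually_mem_nhdsWithin).and (hev.filter_mono nhdsWithin_le_nhds)
  obtain ⟨δ, hδ, hq⟩ := hev'.exists
  choose! q hqU hqE using hq
  have hinj : Set.InjOn q Z := by
    intro p hp p' hp' h
    by_contra hne
    exact Set.disjoint_left.1 (hdisj hp hp' hne) (hqU p hp) (h ▸ hqU p' hp')
  -- This scaling makes the leading terms of the perturbed partial derivatives monic; it multiplies
  -- the Jacobian by c² > 0.
  set c : ℝ := (δ * (d + 1))⁻¹ with hc
  have hc0 : 0 < c := by positivity
  have hg : ∀ i : Fin 2, C c * pderiv i (f + C δ * (X 0 ^ (d + 1) + X 1 ^ (d + 1))) =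
      X i ^ d + C c * pderiv i f := by
    intro i
    have h1 : C c * (C δ * (((d : MvPolynomial (Fin 2) ℝ) + 1) * X i ^ d)) = X i ^ d := by
      rw [← mul_assoc, ← mul_assoc, ← C_mul,
        show ((d : MvPolynomial (Fin 2) ℝ) + 1) = C ((d : ℝ) + 1) by simp, ← C_mul,
        show c * δ * (d + 1) = 1 by rw [hc]; field_simp, C_1, one_mul]
    have h2 : pderiv i (X 0 ^ (d + 1) + X 1 ^ (d + 1) : MvPolynomial (Fin 2) ℝ) =
        ((d : MvPolynomial (Fin 2) ℝ) + 1) * X i ^ d := by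
      fin_cases i <;> simp [pderiv_X_of_ne]
    rw [map_add, pderiv_C_mul, h2, mul_add, h1, add_comm]
  have hdeg : ∀ i, (C c * pderiv i f).totalDegree < d := by
    intro i
    have h1 := totalDegree_mul (C c) (pderiv i f)
    have h2 := totalDegree_pderiv_le i f
    rw [totalDegree_C] at h1
    omega
  have := card_common_zeros_le hd (hdeg 0) (hdeg 1) (Z.image q) (by
    intro p hp
    obtain ⟨p', hp', rfl⟩ := Finset.mem_image.1 hp
    obtain ⟨h1, h2⟩ := hqE p' hp'
    rw [← hg, ← hg]
    simp only [map_mul, h1, mul_zero, true_and, pderiv_C_mul, eval_C]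
    simp only [hess₂, map_sub, map_mul] at h2
    nlinarith [mul_pos (mul_pos hc0 hc0) h2])
  rwa [Finset.card_image_of_injOn hinj] at this

/-! ### Homogenization, change of representative, and the kernel of the Hessian. -/

theorem isHomogeneous_homogenize (d : ℕ) (g : MvPolynomial (Fin 3) ℝ) :
    (homogenize d g).IsHomogeneous d := by
  refine IsHomogeneous.sum _ _ _ fun i hi => ?_
  have h1 := (homogeneousComponent_isHomogeneous i g).rename_isHomogeneous (f := Fin.castSucc)
  have h2 : (X (Fin.last 3) ^ (d - i) : MvPolynomial (Fin 4) ℝ).IsHomogeneous (d - i) :=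
    isHomogeneous_X_pow _ _
  have := h1.mul h2
  rwa [Nat.add_sub_cancel' (by simpa [Nat.lt_succ_iff] using hi)] at this

/-- Dehomogenization: the last variable is replaced by `1`. -/
noncomputable def dehomogenize : MvPolynomial (Fin 4) ℝ →ₐ[ℝ] MvPolynomial (Fin 3) ℝ :=
  aeval (Fin.snoc (α := fun _ => MvPolynomial (Fin 3) ℝ) X 1)

theorem dehomogenize_X_castSucc (i : Fin 3) : dehomogenize (X i.castSucc) = X i := by
  rw [dehomogenize, aeval_X, Fin.snoc_castSucc]

theorem dehomogenize_X_last : dehomogenize (X (Fin.last 3)) = 1 := by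
  rw [dehomogenize, aeval_X, Fin.snoc_last]

theorem eval_dehomogenize (F : MvPolynomial (Fin 4) ℝ) (w : Fin 3 → ℝ) :
    eval w (dehomogenize F) = eval (Fin.snoc (α := fun _ => ℝ) w 1) F := by
  induction F using MvPolynomial.induction_on with
  | C a => simp [dehomogenize]
  | add p q hp hq => simp [hp, hq]
  | mul_X p i hp =>
    rw [map_mul, map_mul, map_mul, hp]
    congr 1
    induction i using Fin.lastCases with
    | last => rw [dehomogenize_X_last, eval_X, Fin.snoc_last, map_one]
    | cast i => rw [dehomogenize_X_castSucc, eval_X, eval_X, Fin.snoc_castSucc]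

theorem dehomogenize_pderiv (F : MvPolynomial (Fin 4) ℝ) (i : Fin 3) :
    dehomogenize (pderiv i.castSucc F) = pderiv i (dehomogenize F) := by
  induction F using MvPolynomial.induction_on with
  | C a => simp [dehomogenize]
  | add p q hp hq => simp [hp, hq]
  | mul_X p j hp =>
    simp only [Derivation.leibniz, map_add, smul_eq_mul, map_mul, hp]
    congr 2
    induction j using Fin.lastCases with
    | last =>
      rw [dehomogenize_X_last, pderiv_X_of_ne (Fin.castSucc_lt_last i).ne']; simp
    | cast j =>
      rw [dehomogenize_X_castSucc, pderiv_X, pderiv_X]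
      by_cases h : i = j
      · subst h; simp
      · rw [Pi.single_eq_of_ne (Ne.symm h), Pi.single_eq_of_ne (fun h' => h
          (Fin.castSucc_injective _ h'.symm)), map_zero]

theorem dehomogenize_homogenize {d : ℕ} {g : MvPolynomial (Fin 3) ℝ} (hg : g.totalDegree ≤ d) :
    dehomogenize (homogenize d g) = g := by
  have h1 : ∀ h : MvPolynomial (Fin 3) ℝ, dehomogenize (rename Fin.castSucc h) = h := by
    intro h
    rw [dehomogenize, aeval_rename]
    have : (Fin.snoc (α := fun _ => MvPolynomial (Fin 3) ℝ) X 1 ∘ Fin.castSucc) = X := by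
      ext1 i; rw [Function.comp_apply, Fin.snoc_castSucc]
    rw [this, aeval_X_left_apply]
  rw [homogenize, map_sum]
  have h2 : ∀ i, dehomogenize (rename Fin.castSucc (homogeneousComponent i g) *
      X (Fin.last 3) ^ (d - i)) = homogeneousComponent i g := by
    intro i
    rw [map_mul, map_pow, dehomogenize_X_last, one_pow, mul_one, h1]
  rw [Finset.sum_congr rfl fun i _ => h2 i]
  conv_rhs => rw [← sum_homogeneousComponent g]
  symm
  apply Finset.sum_subset
  · intro i; simp; omega
  · intro i _ hi
    exact homogeneousComponent_eq_zero _ _ (by simp at hi; omega)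

theorem eval_smul_of_isHomogeneous {σ : Type*} {F : MvPolynomial σ ℝ} {d : ℕ}
    (hF : F.IsHomogeneous d) (c : ℝ) (v : σ → ℝ) : eval (c • v) F = c ^ d * eval v F := by
  rw [eval_eq, eval_eq, Finset.mul_sum]
  refine Finset.sum_congr rfl fun s hs => ?_
  simp only [Pi.smul_apply, smul_eq_mul, mul_pow, Finset.prod_mul_distrib]
  rw [Finset.prod_pow_eq_pow_sum, hF.degree_eq_sum_deg_support hs]
  change _ = (c ^ ∑ i ∈ s.support, s i) * _
  ring

theorem hessian_smul {F : MvPolynomial (Fin 4) ℝ} {d : ℕ} (hF : F.IsHomogeneous d) (c : ℝ)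
    (v : Fin 4 → ℝ) : hessian F (c • v) = c ^ (d - 1 - 1) • hessian F v := by
  ext i j
  exact eval_smul_of_isHomogeneous hF.pderiv.pderiv c v

theorem rank_smul_of_ne_zero {n : Type*} [Fintype n] [DecidableEq n] (A : Matrix n n ℝ) {c : ℝ}
    (hc : c ≠ 0) :
    (c • A).rank = A.rank :=
  rank_smul_of_mem_nonZeroDivisors A (mem_nonZeroDivisors_of_ne_zero hc)

theorem semidef_smul {n : Type*} [Fintype n] {A : Matrix n n ℝ} (c : ℝ)
    (h : A.PosSemidef ∨ (-A).PosSemidef) : (c • A).PosSemidef ∨ (-(c • A)).PosSemidef := by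
  rcases le_total 0 c with hc | hc
  · rcases h with h | h
    · exact Or.inl (h.smul hc)
    · exact Or.inr (by rw [← smul_neg]; exact h.smul hc)
  · rcases h with h | h
    · exact Or.inr (by rw [← neg_smul]; exact h.smul (neg_nonneg.2 hc))
    · refine Or.inl ?_
      have := h.smul (neg_nonneg.2 hc)
      rwa [neg_smul_neg] at this

theorem IsSolitary.smul {F : MvPolynomial (Fin 4) ℝ} {d : ℕ} (hF : F.IsHomogeneous d) {c : ℝ}
    (hc : c ≠ 0) {v : Fin 4 → ℝ} (h : IsSolitary F v) : IsSolitary F (c • v) := by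
  obtain ⟨⟨h0, h1, h2⟩, h3⟩ := h
  refine ⟨⟨?_, fun i => ?_, ?_⟩, ?_⟩
  · rw [eval_smul_of_isHomogeneous hF, h0, mul_zero]
  · rw [eval_smul_of_isHomogeneous hF.pderiv, h1, mul_zero]
  · rw [hessian_smul hF, rank_smul_of_ne_zero _ (pow_ne_zero _ hc), h2]
  · rw [hessian_smul hF]
    exact semidef_smul _ h3

/-- Euler's relation applied to each first partial derivative. A singular point therefore always
lies in the kernel of its Hessian, and rank `3` means that it spans this kernel. -/
theorem hessian_mulVec_self {F : MvPolynomial (Fin 4) ℝ} {d : ℕ} (hF : F.IsHomogeneous d)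
    {v : Fin 4 → ℝ} (h : ∀ i, eval v (pderiv i F) = 0) : hessian F v *ᵥ v = 0 := by
  ext i
  have := congrArg (eval v) (hF.pderiv (i := i)).sum_X_mul_pderiv
  simp only [map_sum, map_mul, eval_X, map_nsmul, h i, smul_zero] at this
  rw [Pi.zero_apply, ← this]
  simp only [mulVec, dotProduct, hessian, of_apply]
  exact Finset.sum_congr rfl fun j _ => by rw [pderiv_comm, mul_comm]

theorem hessian_transpose (F : MvPolynomial (Fin 4) ℝ) (v : Fin 4 → ℝ) :
    (hessian F v).IsHermitian := by
  ext i j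
  simp [hessian, pderiv_comm i j]

/-- A `4 × 4` matrix has rank `3` iff its kernel is a line. -/
theorem rank_eq_three_iff {A : Matrix (Fin 4) (Fin 4) ℝ} {v : Fin 4 → ℝ} (hv : v ≠ 0)
    (hAv : A *ᵥ v = 0) : A.rank = 3 ↔ ∀ u, A *ᵥ u = 0 → ∃ c : ℝ, u = c • v := by
  have h1 := A.mulVecLin.finrank_range_add_finrank_ker
  rw [Module.finrank_fintype_fun_eq_card, Fintype.card_fin] at h1
  have hv' : (⟨v, by simpa using hAv⟩ : LinearMap.ker A.mulVecLin) ≠ 0 := by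
    simpa [Subtype.ext_iff] using hv
  have h2 := finrank_eq_one_iff_of_nonzero' (K := ℝ) _ hv'
  have h3 : A.rank = 3 ↔ Module.finrank ℝ (LinearMap.ker A.mulVecLin) = 1 := by
    rw [Matrix.rank]; omega
  rw [h3, h2]
  constructor
  · intro h u hu
    obtain ⟨c, hc⟩ := h ⟨u, by simpa using hu⟩
    exact ⟨c, by simpa [Subtype.ext_iff] using hc.symm⟩
  · rintro h ⟨u, hu⟩
    obtain ⟨c, hc⟩ := h u (by simpa using hu)
    exact ⟨c, by simpa [Subtype.ext_iff] using hc.symm⟩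

/-! ### Affine solitary points as tangencies between levels of `f` and of T_d. -/

/-- The affine point `(x, y, z)` in homogeneous coordinates. -/
noncomputable def affinePoint (q : Fin 2 → ℝ) (z : ℝ) : Fin 4 → ℝ :=
  Fin.snoc (α := fun _ => ℝ) (Fin.snoc (α := fun _ => ℝ) q z) 1

noncomputable abbrev chebyshev (d : ℕ) : Polynomial ℝ := Polynomial.Chebyshev.T ℝ (d : ℤ)

theorem natDegree_chebyshev (d : ℕ) : (chebyshev d).natDegree = d := by
  simp [chebyshev]

theorem totalDegree_affineEquation {d : ℕ} {f : MvPolynomial (Fin 2) ℝ} (hf : f.totalDegree ≤ d) :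
    (affineEquation d f).totalDegree ≤ d := by
  refine (totalDegree_sub _ _).trans (max_le ((totalDegree_rename_le _ _).trans hf) ?_)
  rw [Polynomial.aeval_eq_sum_range]
  refine totalDegree_finsetSum_le fun i hi => ?_
  refine (totalDegree_smul_le _ _).trans ?_
  rw [totalDegree_X_pow]
  have : (Polynomial.Chebyshev.T ℝ (d : ℤ)).natDegree = d := natDegree_chebyshev d
  simp only [Finset.mem_range] at hi
  omega

theorem pderiv_castSucc_rename (f : MvPolynomial (Fin 2) ℝ) (i : Fin 2) :
    pderiv i.castSucc (rename Fin.castSucc f) = rename Fin.castSucc (pderiv i f) :=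
  pderiv_rename (Fin.castSucc_injective _) i f

theorem pderiv_last_rename {n : ℕ} (f : MvPolynomial (Fin n) ℝ) :
    pderiv (Fin.last n) (rename Fin.castSucc f) = 0 := by
  classical
  apply pderiv_eq_zero_of_notMem_vars
  intro h
  obtain ⟨j, -, hj⟩ := Finset.mem_image.1 (vars_rename _ _ h)
  exact (Fin.castSucc_lt_last j).ne hj

theorem pderiv_castSucc_aeval (P : Polynomial ℝ) (i : Fin 2) :
    pderiv i.castSucc (Polynomial.aeval (X (Fin.last 2) : MvPolynomial (Fin 3) ℝ) P) = 0 := by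
  rw [Derivation.map_aeval, pderiv_X_of_ne (Fin.castSucc_lt_last i).ne', smul_zero]

theorem pderiv_last_aeval (P : Polynomial ℝ) :
    pderiv (Fin.last 2) (Polynomial.aeval (X (Fin.last 2) : MvPolynomial (Fin 3) ℝ) P) =
      Polynomial.aeval (X (Fin.last 2)) (Polynomial.derivative P) := by
  rw [Derivation.map_aeval, pderiv_X_self, smul_eq_mul, mul_one]

theorem eval_snoc_rename (f : MvPolynomial (Fin 2) ℝ) (q : Fin 2 → ℝ) (z : ℝ) :
    eval (Fin.snoc (α := fun _ => ℝ) q z) (rename Fin.castSucc f) = eval q f := by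
  rw [eval_rename]
  congr 2
  ext i; simp

theorem eval_snoc_aeval (P : Polynomial ℝ) (q : Fin 2 → ℝ) (z : ℝ) :
    eval (Fin.snoc (α := fun _ => ℝ) q z)
      (Polynomial.aeval (X (Fin.last 2) : MvPolynomial (Fin 3) ℝ) P) = P.eval z := by
  rw [← MvPolynomial.coe_aeval_eq_eval]
  simp only [RingHom.coe_coe]
  rw [← Polynomial.aeval_algHom_apply, aeval_X, Fin.snoc_last, Polynomial.coe_aeval_eq_eval]

theorem eval_equation {d : ℕ} {f : MvPolynomial (Fin 2) ℝ} (hf : f.totalDegree ≤ d)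
    (q : Fin 2 → ℝ) (z : ℝ) :
    eval (affinePoint q z) (equation d f) = eval q f - (chebyshev d).eval z := by
  rw [affinePoint, ← eval_dehomogenize, equation, dehomogenize_homogenize
    (totalDegree_affineEquation hf), affineEquation, map_sub, eval_snoc_rename, eval_snoc_aeval]

theorem pderiv_castSucc_affineEquation (d : ℕ) (f : MvPolynomial (Fin 2) ℝ) (k : Fin 2) :
    pderiv k.castSucc (affineEquation d f) = rename Fin.castSucc (pderiv k f) := by
  rw [affineEquation, map_sub, pderiv_castSucc_rename, pderiv_castSucc_aeval, sub_zero]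

theorem pderiv_last_affineEquation (d : ℕ) (f : MvPolynomial (Fin 2) ℝ) :
    pderiv (Fin.last 2) (affineEquation d f) =
      - Polynomial.aeval (X (Fin.last 2)) (Polynomial.derivative (chebyshev d)) := by
  rw [affineEquation, map_sub, pderiv_last_rename, pderiv_last_aeval, zero_sub]

theorem eval_pderiv_equation {d : ℕ} {f : MvPolynomial (Fin 2) ℝ} (hf : f.totalDegree ≤ d)
    (q : Fin 2 → ℝ) (z : ℝ) (i : Fin 3) :
    eval (affinePoint q z) (pderiv i.castSucc (equation d f)) =
      eval (Fin.snoc (α := fun _ => ℝ) q z) (pderiv i (affineEquation d f)) := by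
  rw [affinePoint, ← eval_dehomogenize, dehomogenize_pderiv, equation, dehomogenize_homogenize
    (totalDegree_affineEquation hf)]

theorem hessian_castSucc {d : ℕ} {f : MvPolynomial (Fin 2) ℝ} (hf : f.totalDegree ≤ d)
    (q : Fin 2 → ℝ) (z : ℝ) (i j : Fin 3) :
    hessian (equation d f) (affinePoint q z) i.castSucc j.castSucc =
      eval (Fin.snoc (α := fun _ => ℝ) q z) (pderiv i (pderiv j (affineEquation d f))) := by
  rw [hessian, of_apply, affinePoint, ← eval_dehomogenize, dehomogenize_pderiv,
    dehomogenize_pderiv, equation, dehomogenize_homogenize (totalDegree_affineEquation hf)]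

theorem hessian_apply_base {d : ℕ} {f : MvPolynomial (Fin 2) ℝ} (hf : f.totalDegree ≤ d)
    (q : Fin 2 → ℝ) (z : ℝ) (k l : Fin 2) :
    hessian (equation d f) (affinePoint q z) k.castSucc.castSucc l.castSucc.castSucc =
      eval q (pderiv k (pderiv l f)) := by
  rw [hessian_castSucc hf, pderiv_castSucc_affineEquation, pderiv_castSucc_rename,
    eval_snoc_rename]

theorem hessian_apply_mixed {d : ℕ} {f : MvPolynomial (Fin 2) ℝ} (hf : f.totalDegree ≤ d)
    (q : Fin 2 → ℝ) (z : ℝ) (l : Fin 2) :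
    hessian (equation d f) (affinePoint q z) 2 l.castSucc.castSucc = 0 := by
  rw [show (2 : Fin 4) = (Fin.last 2).castSucc from rfl, hessian_castSucc hf,
    pderiv_castSucc_affineEquation, pderiv_last_rename, map_zero]

theorem hessian_apply_vertical {d : ℕ} {f : MvPolynomial (Fin 2) ℝ} (hf : f.totalDegree ≤ d)
    (q : Fin 2 → ℝ) (z : ℝ) :
    hessian (equation d f) (affinePoint q z) 2 2 =
      - (Polynomial.derivative (Polynomial.derivative (chebyshev d))).eval z := by
  rw [show (2 : Fin 4) = (Fin.last 2).castSucc from rfl, hessian_castSucc hf,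
    pderiv_last_affineEquation, map_neg, pderiv_last_aeval, map_neg, eval_snoc_aeval]

theorem affinePoint_ne_zero (q : Fin 2 → ℝ) (z : ℝ) : affinePoint q z ≠ 0 := by
  intro h
  have := congrFun h (Fin.last 3)
  rw [affinePoint, Fin.snoc_last] at this
  exact one_ne_zero this

@[simp] theorem affinePoint_three (q : Fin 2 → ℝ) (z : ℝ) : affinePoint q z 3 = 1 := rfl
@[simp] theorem affinePoint_two (q : Fin 2 → ℝ) (z : ℝ) : affinePoint q z 2 = z := rfl
@[simp] theorem affinePoint_one (q : Fin 2 → ℝ) (z : ℝ) : affinePoint q z 1 = q 1 := rfl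
@[simp] theorem affinePoint_zero (q : Fin 2 → ℝ) (z : ℝ) : affinePoint q z 0 = q 0 := rfl

/-- The tangency data of an affine solitary point. -/
theorem IsSolitary.affine {d : ℕ} {f : MvPolynomial (Fin 2) ℝ} (hf : f.totalDegree ≤ d)
    {q : Fin 2 → ℝ} {z : ℝ} (h : IsSolitary (equation d f) (affinePoint q z)) :
    q ∈ extrema f ∧ (Polynomial.derivative (chebyshev d)).eval z = 0 ∧
      (chebyshev d).eval z = eval q f := by
  obtain ⟨⟨h0, h1, h2⟩, h3⟩ := h
  have hz : (Polynomial.derivative (chebyshev d)).eval z = 0 := by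
    have := h1 (Fin.last 2).castSucc
    rwa [eval_pderiv_equation hf, pderiv_last_affineEquation, map_neg, eval_snoc_aeval,
      neg_eq_zero] at this
  have hgrad : ∀ i, eval q (pderiv i f) = 0 := by
    intro i
    have := h1 i.castSucc.castSucc
    rwa [eval_pderiv_equation hf, pderiv_castSucc_affineEquation, eval_snoc_rename] at this
  rw [eval_equation hf] at h0
  refine ⟨⟨hgrad, ?_⟩, hz, by linarith⟩
  have hker := hessian_mulVec_self (isHomogeneous_homogenize d _) h1
  change hessian (equation d f) (affinePoint q z) *ᵥ affinePoint q z = 0 at hker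
  rw [rank_eq_three_iff (affinePoint_ne_zero q z) hker] at h2
  set H := hessian (equation d f) (affinePoint q z) with hH
  set e : Fin 2 → Fin 4 := fun k => k.castSucc.castSucc with he
  have hB : ∀ k l, H.submatrix e e k l = eval q (pderiv k (pderiv l f)) := fun k l =>
    hessian_apply_base hf q z k l
  have hdet : eval q (hess₂ f) = (H.submatrix e e).det := by
    rw [det_fin_two, hB, hB, hB, hB, hess₂, map_sub, map_mul, map_mul]; ring
  have hzero : ∀ x : Fin 4 → ℝ, x ⬝ᵥ (H *ᵥ x) = 0 → H *ᵥ x = 0 := by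
    intro x hx
    rcases h3 with h3 | h3
    · exact (h3.dotProduct_mulVec_zero_iff x).1 (by simpa using hx)
    · have := (h3.dotProduct_mulVec_zero_iff x).1 (by simpa [neg_mulVec] using hx)
      simpa [neg_mulVec] using this
  have hnonneg : 0 ≤ (H.submatrix e e).det := by
    rcases h3 with h3 | h3
    · exact (h3.submatrix e).det_nonneg
    · have := (h3.submatrix e).det_nonneg
      rwa [submatrix_neg, Pi.neg_apply, Pi.neg_apply, det_neg, Fintype.card_fin, neg_one_sq,
        one_mul] at this
  rw [hdet]
  -- A null vector of the xy-block, extended by zeros, would be isotropic for a semidefinite form,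
  -- hence in its kernel and a multiple of the point. Its last coordinate is `0` while that of the
  -- point is `1`, so it would vanish.
  refine lt_of_le_of_ne hnonneg fun h => ?_
  obtain ⟨u, hu0, hu⟩ := exists_mulVec_eq_zero_iff.2 h.symm
  have hx : ![u 0, u 1, 0, 0] ⬝ᵥ (H *ᵥ ![u 0, u 1, 0, 0]) = u ⬝ᵥ ((H.submatrix e e) *ᵥ u) := by
    simp [mulVec, dotProduct, Fin.sum_univ_four, Fin.sum_univ_two, he]
  rw [hu, dotProduct_zero] at hx
  obtain ⟨c, hc⟩ := h2 _ (hzero _ hx)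
  have hc0 : c = 0 := by simpa using (congrFun hc 3).symm
  apply hu0
  ext k
  fin_cases k
  · simpa [hc0] using congrFun hc 0
  · simpa [hc0] using congrFun hc 1

/-- A symmetric `4 × 4` matrix with a kernel vector `v` and block form `(a b; b c) ⊕ (-t)` on the
complement, where `a c > b ^ 2` and `a t < 0`, is semidefinite of rank `3`. -/
theorem rank_and_semidef_of_block {H : Matrix (Fin 4) (Fin 4) ℝ} (hH : H.IsHermitian)
    {v : Fin 4 → ℝ} (hv : v 3 = 1) (hker : H *ᵥ v = 0) {a b c t : ℝ}
    (e00 : H 0 0 = a) (e01 : H 0 1 = b) (e11 : H 1 1 = c) (e20 : H 2 0 = 0) (e21 : H 2 1 = 0)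
    (e22 : H 2 2 = -t) (hdet : 0 < a * c - b * b) (hsign : a * t < 0) :
    H.rank = 3 ∧ (H.PosSemidef ∨ (-H).PosSemidef) := by
  have hsymm : Hᵀ = H := hH
  have e10 : H 1 0 = b := by rw [← e01]; exact congrFun (congrFun hsymm 0) 1
  have e02 : H 0 2 = 0 := by rw [← e20]; exact congrFun (congrFun hsymm 2) 0
  have e12 : H 1 2 = 0 := by rw [← e21]; exact congrFun (congrFun hsymm 2) 1
  have hv0 : v ≠ 0 := by rintro rfl; simp at hv
  have hform : ∀ x : Fin 4 → ℝ, x ⬝ᵥ (H *ᵥ x) =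
      a * (x 0 - x 3 * v 0) ^ 2 + 2 * b * ((x 0 - x 3 * v 0) * (x 1 - x 3 * v 1)) +
        c * (x 1 - x 3 * v 1) ^ 2 - t * (x 2 - x 3 * v 2) ^ 2 := by
    intro x
    -- Subtracting a multiple of the kernel vector does not change the form and moves `x` into the
    -- hyperplane where the last coordinate is `0`; only the given blocks remain.
    obtain ⟨y, hy⟩ : ∃ y, y = x - x 3 • v := ⟨_, rfl⟩
    have hx : x = y + x 3 • v := by rw [hy]; simp
    have h2 : x ⬝ᵥ (H *ᵥ x) = y ⬝ᵥ (H *ᵥ y) := by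
      have hyx : H *ᵥ x = H *ᵥ y := by rw [hx, mulVec_add, mulVec_smul, hker]; simp
      have hvy : v ⬝ᵥ (H *ᵥ y) = 0 := by
        rw [dotProduct_mulVec, ← mulVec_transpose, hsymm, hker, zero_dotProduct]
      rw [hyx]
      conv_lhs => rw [hx]
      rw [add_dotProduct, smul_dotProduct, hvy, smul_zero, add_zero]
    have y0 : y 0 = x 0 - x 3 * v 0 := by rw [hy]; simp
    have y1 : y 1 = x 1 - x 3 * v 1 := by rw [hy]; simp
    have y2 : y 2 = x 2 - x 3 * v 2 := by rw [hy]; simp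
    have y3 : y 3 = 0 := by rw [hy]; simp [hv]
    rw [h2, ← y0, ← y1, ← y2]
    simp only [mulVec, dotProduct, Fin.sum_univ_four, y3, e00, e01, e10, e11, e20, e21, e22, e02,
      e12]
    ring
  -- Completing the square: `a` times the form is (ax + by)² + (ac - b²)y² - at w², a sum of
  -- nonnegative terms.
  have key : ∀ x y w : ℝ, 0 ≤ a * (a * x ^ 2 + 2 * b * (x * y) + c * y ^ 2 - t * w ^ 2) := by
    intro x y w
    nlinarith [sq_nonneg (a * x + b * y), mul_nonneg hdet.le (sq_nonneg y),
      mul_nonneg (neg_nonneg.2 hsign.le) (sq_nonneg w)]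
  have key0 : ∀ x y w : ℝ, a * x ^ 2 + 2 * b * (x * y) + c * y ^ 2 - t * w ^ 2 = 0 →
      x = 0 ∧ y = 0 ∧ w = 0 := by
    intro x y w h
    have e : (a * x + b * y) ^ 2 + (a * c - b * b) * y ^ 2 + -(a * t) * w ^ 2 = 0 := by
      linear_combination a * h
    have s1 := sq_nonneg (a * x + b * y)
    have s2 := mul_nonneg hdet.le (sq_nonneg y)
    have s3 := mul_nonneg (neg_nonneg.2 hsign.le) (sq_nonneg w)
    have hy : y = 0 := by
      have : (a * c - b * b) * y ^ 2 = 0 := by linarith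
      simpa [hdet.ne'] using this
    have hw : w = 0 := by
      have : -(a * t) * w ^ 2 = 0 := by linarith
      simpa [(mul_ne_zero_iff.1 hsign.ne).1, (mul_ne_zero_iff.1 hsign.ne).2] using this
    have hx : (a * x + b * y) ^ 2 = 0 := by linarith
    refine ⟨?_, hy, hw⟩
    simpa [hy, (mul_ne_zero_iff.1 hsign.ne).1] using hx
  refine ⟨(rank_eq_three_iff hv0 hker).2 fun u hu => ⟨u 3, ?_⟩, ?_⟩
  · have := hform u
    rw [hu, dotProduct_zero] at this
    obtain ⟨r0, r1, r2⟩ := key0 _ _ _ this.symm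
    ext i
    fin_cases i
    · simpa [sub_eq_zero] using r0
    · simpa [sub_eq_zero] using r1
    · simpa [sub_eq_zero] using r2
    · simp [hv]
  · have ha0 : a ≠ 0 := (mul_ne_zero_iff.1 hsign.ne).1
    rcases ha0.lt_or_gt with hneg | hpos
    · right
      refine PosSemidef.of_dotProduct_mulVec_nonneg hH.neg fun x => ?_
      rw [star_trivial, neg_mulVec, dotProduct_neg, hform]
      nlinarith [key (x 0 - x 3 * v 0) (x 1 - x 3 * v 1) (x 2 - x 3 * v 2)]
    · left
      refine PosSemidef.of_dotProduct_mulVec_nonneg hH fun x => ?_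
      rw [star_trivial, hform]
      exact nonneg_of_mul_nonneg_right (key _ _ _) hpos

/-- The sign hypothesis says that `f` at `q` and -T_d at `z` bend in the same direction, so the
blocks of the Hessian are definite with the same sign. The partial derivative in the homogenizing
variable vanishes by Euler's relation. -/
theorem isSolitary_affinePoint {d : ℕ} {f : MvPolynomial (Fin 2) ℝ} (hf : f.totalDegree ≤ d)
    {q : Fin 2 → ℝ} {z : ℝ} (hq : q ∈ extrema f)
    (hz : (Polynomial.derivative (chebyshev d)).eval z = 0)
    (hqz : (chebyshev d).eval z = eval q f)
    (hsign : eval q (pderiv 0 (pderiv 0 f)) *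
      (Polynomial.derivative (Polynomial.derivative (chebyshev d))).eval z < 0) :
    IsSolitary (equation d f) (affinePoint q z) := by
  have hF := isHomogeneous_homogenize d (affineEquation d f)
  change (equation d f).IsHomogeneous d at hF
  have h0 : eval (affinePoint q z) (equation d f) = 0 := by rw [eval_equation hf, hqz, sub_self]
  have h1' : ∀ i : Fin 3, eval (affinePoint q z) (pderiv i.castSucc (equation d f)) = 0 := by
    intro i
    rw [eval_pderiv_equation hf]
    induction i using Fin.lastCases with
    | last => rw [pderiv_last_affineEquation, map_neg, eval_snoc_aeval, hz, neg_zero]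
    | cast i => rw [pderiv_castSucc_affineEquation, eval_snoc_rename, hq.1]
  have h1 : ∀ i, eval (affinePoint q z) (pderiv i (equation d f)) = 0 := by
    intro i
    induction i using Fin.lastCases with
    | cast i => exact h1' i
    | last =>
      have := congrArg (eval (affinePoint q z)) hF.sum_X_mul_pderiv
      rw [map_nsmul, h0, smul_zero, Fin.sum_univ_castSucc, map_add, map_sum,
        Finset.sum_eq_zero fun i _ => by rw [map_mul, h1' i, mul_zero], zero_add, map_mul, eval_X]
        at this
      have h3 : affinePoint q z (Fin.last 3) = 1 := rfl
      rwa [h3, one_mul] at this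
  have hker := hessian_mulVec_self hF h1
  have hdet : 0 < eval q (pderiv 0 (pderiv 0 f)) * eval q (pderiv 1 (pderiv 1 f)) -
      eval q (pderiv 0 (pderiv 1 f)) * eval q (pderiv 0 (pderiv 1 f)) := by
    have := hq.2
    rwa [hess₂, map_sub, map_mul, map_mul, pderiv_comm 1 0 f] at this
  obtain ⟨h2, h3⟩ := rank_and_semidef_of_block (hessian_transpose _ _) (affinePoint_three q z) hker
    (hessian_apply_base hf q z 0 0) (hessian_apply_base hf q z 0 1) (hessian_apply_base hf q z 1 1)
    (hessian_apply_mixed hf q z 0) (hessian_apply_mixed hf q z 1) (hessian_apply_vertical hf q z)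
    hdet hsign
  exact ⟨⟨h0, h1, h2⟩, h3⟩

/-! ### Points at infinity and degrees at most two. -/

theorem homogenize_aeval {d : ℕ} (P : Polynomial ℝ) (hP : P.natDegree = d) :
    homogenize d (Polynomial.aeval (X (Fin.last 2)) P) =
      ∑ i ∈ Finset.range (d + 1), C (P.coeff i) * (X 2 ^ i * X 3 ^ (d - i)) := by
  rw [homogenize]
  refine Finset.sum_congr rfl fun i hi => ?_
  have h1 : ∀ j, homogeneousComponent i (P.coeff j • (X (Fin.last 2) : MvPolynomial (Fin 3) ℝ) ^ j)
      = if i = j then P.coeff j • (X (Fin.last 2)) ^ j else 0 := fun j => by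
    rw [map_smul, homogeneousComponent_of_mem (isHomogeneous_X_pow _ _), smul_ite, smul_zero]
  rw [Polynomial.aeval_eq_sum_range, hP, map_sum, Finset.sum_congr rfl fun j _ => h1 j,
    Finset.sum_ite_eq, if_pos hi, map_smul, map_pow, rename_X, smul_eq_C_mul, mul_assoc]
  rfl

/-- The part coming from `f` does not involve z, so what remains is a binary form of degree d-1 in z
and the homogenizing variable. This controls the behaviour at infinity for every `f`. -/
theorem pderiv_two_equation (d : ℕ) (f : MvPolynomial (Fin 2) ℝ) :
    pderiv 2 (equation d f) = - ∑ i ∈ Finset.range (d + 1),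
      C ((chebyshev d).coeff i) * (C (i : ℝ) * (X 2 ^ (i - 1) * X 3 ^ (d - i))) := by
  have h1 : equation d f = homogenize d (rename Fin.castSucc f) -
      homogenize d (Polynomial.aeval (X (Fin.last 2)) (chebyshev d)) := by
    simp only [equation, affineEquation, homogenize, map_sub, sub_mul, Finset.sum_sub_distrib]
  have h2 : pderiv 2 (homogenize d (rename Fin.castSucc f)) = 0 := by
    rw [homogenize, map_sum]
    refine Finset.sum_eq_zero fun i _ => ?_
    have h3 : pderiv (2 : Fin 4) (rename Fin.castSucc
        (homogeneousComponent i (rename (Fin.castSucc : Fin 2 → Fin 3) f))) = 0 := by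
      rw [show (2 : Fin 4) = (Fin.last 2).castSucc from rfl,
        pderiv_rename (Fin.castSucc_injective _), ← rename_homogeneousComponent,
        pderiv_last_rename, map_zero]
    have h4 : pderiv (2 : Fin 4) (X (Fin.last 3) : MvPolynomial (Fin 4) ℝ) = 0 :=
      pderiv_X_of_ne (by decide)
    rw [Derivation.leibniz, h3, pderiv_pow, h4]
    simp
  rw [h1, map_sub, h2, zero_sub, homogenize_aeval _ (natDegree_chebyshev d), map_sum]
  congr 1
  refine Finset.sum_congr rfl fun i _ => ?_
  have h4 : pderiv (2 : Fin 4) (X 3 : MvPolynomial (Fin 4) ℝ) = 0 := pderiv_X_of_ne (by decide)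
  rw [pderiv_C_mul, Derivation.leibniz, pderiv_pow, pderiv_pow, h4, pderiv_X_self]
  simp only [mul_zero, smul_zero, zero_add, smul_eq_mul, mul_one, map_natCast]
  ring

theorem eval_pderiv_pow_mul_pow {v : Fin 4 → ℝ} (h2 : v 2 = 0) (h3 : v 3 = 0) {a b : ℕ}
    (hab : 2 ≤ a + b) (j : Fin 4) :
    eval v (pderiv j (X 2 ^ a * X 3 ^ b : MvPolynomial (Fin 4) ℝ)) = 0 := by
  rw [Derivation.leibniz, pderiv_pow, pderiv_pow]
  simp only [smul_eq_mul, map_add, map_mul, map_pow, eval_X, h2, h3, map_natCast]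
  rcases a with _ | _ | a <;> rcases b with _ | _ | b <;> simp at *

/-- At infinity the z-derivative reduces to a nonzero multiple of z^(d-1), so a singular point there
has z = 0. For d ≥ 3 all derivatives of this binary form of degree d-1 ≥ 2 vanish there too, so the
z-axis vector is in the kernel of the Hessian. It is not proportional to the point, so the rank is
below `3`. -/
theorem not_isSolitary_at_infinity {d : ℕ} (hd : 3 ≤ d) (f : MvPolynomial (Fin 2) ℝ)
    {v : Fin 4 → ℝ} (hv : v ≠ 0) (hv3 : v 3 = 0) : ¬ IsSolitary (equation d f) v := by
  rintro ⟨⟨-, h1, h2⟩, -⟩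
  have hker := hessian_mulVec_self (isHomogeneous_homogenize d _) h1
  change hessian (equation d f) v *ᵥ v = 0 at hker
  have hv2 : v 2 = 0 := by
    have := h1 2
    rw [pderiv_two_equation, map_neg, map_sum, neg_eq_zero, Finset.sum_range_succ,
      Finset.sum_eq_zero] at this
    · have hc : (chebyshev d).coeff d ≠ 0 := by
        conv => lhs; arg 2; rw [← natDegree_chebyshev d]
        rw [Polynomial.coeff_natDegree, Polynomial.leadingCoeff_ne_zero]
        intro h
        have := natDegree_chebyshev d
        rw [h] at this
        simp at this; omega
      simpa [hc, show d ≠ 0 by omega, show d - 1 ≠ 0 by omega] using this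
    · intro i hi
      simp [hv3, show d - i ≠ 0 by simp at hi; omega]
  rw [rank_eq_three_iff hv hker] at h2
  obtain ⟨c, hc⟩ := h2 (Pi.single 2 1) (by
    ext i
    rw [mulVec_single_one, Pi.zero_apply, col_apply, hessian, of_apply, pderiv_two_equation,
      map_neg, map_sum, map_neg, map_sum, neg_eq_zero]
    refine Finset.sum_eq_zero fun k hk => ?_
    rw [pderiv_C_mul, pderiv_C_mul, map_mul, map_mul]
    rcases k.eq_zero_or_pos with rfl | hk0
    · simp
    · rw [eval_pderiv_pow_mul_pow hv2 hv3 (by simp at hk; omega), mul_zero, mul_zero])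
  have := congrFun hc 2
  simp [hv2] at this

/-- In degree at most two the Hessian is constant, and each solitary point spans its one-dimensional
kernel. -/
theorem subsingleton_solitaryPoints {d : ℕ} (hd : d ≤ 2) (f : MvPolynomial (Fin 2) ℝ) :
    (solitaryPoints (equation d f)).Subsingleton := by
  have hF : (equation d f).IsHomogeneous d := isHomogeneous_homogenize d _
  intro p hp p' hp'
  have hconst : hessian (equation d f) p.rep = hessian (equation d f) p'.rep := by
    -- Scaling by `0` with exponent `0` compares the Hessian at any representative with the one at
    -- the origin.
    have h0 := hessian_smul hF 0 p.rep
    have h0' := hessian_smul hF 0 p'.rep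
    rw [show d - 1 - 1 = 0 by omega, pow_zero, one_smul] at h0 h0'
    rw [← h0, ← h0', zero_smul, zero_smul]
  have hk := hessian_mulVec_self hF hp.1.2.1
  have hk' := hessian_mulVec_self hF hp'.1.2.1
  rw [← hconst] at hk'
  obtain ⟨c, hc⟩ := (rank_eq_three_iff p.rep_nonzero hk).1 hp.1.2.2 _ hk'
  rw [← p.mk_rep, ← p'.mk_rep, eq_comm, Projectivization.mk_eq_mk_iff']
  exact ⟨c, hc.symm⟩

/-! ### The upper bound in projective space. -/

/-- The affine chart of the projective space. -/
noncomputable def chart (w : (Fin 2 → ℝ) × ℝ) : Projectivization ℝ (Fin 4 → ℝ) :=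
  Projectivization.mk ℝ (affinePoint w.1 w.2) (affinePoint_ne_zero _ _)

theorem chart_injective : Function.Injective chart := by
  rintro ⟨q, z⟩ ⟨q', z'⟩ h
  rw [chart, chart, Projectivization.mk_eq_mk_iff'] at h
  obtain ⟨c, hc⟩ := h
  have h3 : c = 1 := by simpa using congrFun hc 3
  subst h3
  rw [one_smul] at hc
  refine Prod.ext (funext fun i => ?_) ?_
  · fin_cases i
    exacts [(congrFun hc 0).symm, (congrFun hc 1).symm]
  · exact (congrFun hc 2).symm

theorem chart_mem_solitaryPoints {F : MvPolynomial (Fin 4) ℝ} {d : ℕ} (hF : F.IsHomogeneous d)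
    {w : (Fin 2 → ℝ) × ℝ} : chart w ∈ solitaryPoints F ↔ IsSolitary F (affinePoint w.1 w.2) := by
  obtain ⟨a, ha⟩ := Projectivization.exists_smul_eq_mk_rep ℝ (affinePoint w.1 w.2)
    (affinePoint_ne_zero _ _)
  change IsSolitary F (chart w).rep ↔ _
  rw [chart, ← ha]
  refine ⟨fun h => ?_, fun h => h.smul hF a.ne_zero⟩
  have := h.smul hF (inv_ne_zero a.ne_zero)
  rwa [Units.smul_def, smul_smul, inv_mul_cancel₀ a.ne_zero, one_smul] at this

theorem exists_chart_eq {p : Projectivization ℝ (Fin 4 → ℝ)} (hp : p.rep 3 ≠ 0) :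
    ∃ w, chart w = p := by
  refine ⟨(![p.rep 0 / p.rep 3, p.rep 1 / p.rep 3], p.rep 2 / p.rep 3), ?_⟩
  conv_rhs => rw [← p.mk_rep]
  rw [chart, Projectivization.mk_eq_mk_iff']
  refine ⟨(p.rep 3)⁻¹, ?_⟩
  ext i
  fin_cases i <;> simp [div_eq_inv_mul, hp]

/-- The tangency data of the affine solitary points. -/
def tangencies (d : ℕ) (f : MvPolynomial (Fin 2) ℝ) : Set ((Fin 2 → ℝ) × ℝ) :=
  {w | w.1 ∈ extrema f ∧ (Polynomial.derivative (chebyshev d)).eval w.2 = 0 ∧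
      (chebyshev d).eval w.2 = eval w.1 f}

theorem solitaryPoints_subset {d : ℕ} (hd : 3 ≤ d) {f : MvPolynomial (Fin 2) ℝ}
    (hf : f.totalDegree ≤ d) : solitaryPoints (equation d f) ⊆ chart '' tangencies d f := by
  intro p hp
  obtain ⟨w, rfl⟩ := exists_chart_eq (p := p) fun h =>
    not_isSolitary_at_infinity hd f p.rep_nonzero h hp
  exact ⟨w, ((chart_mem_solitaryPoints (isHomogeneous_homogenize d _)).1 hp).affine hf, rfl⟩

theorem finite_extrema {d : ℕ} (hd : 2 ≤ d) {f : MvPolynomial (Fin 2) ℝ}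
    (hf : f.totalDegree ≤ d) : (extrema f).Finite := by
  by_contra h
  obtain ⟨Z, hZ, hcard⟩ := Set.Infinite.exists_subset_card_eq h (d * (d + 1) + 1)
  have := card_extrema_le hd hf Z fun p hp => hZ hp
  omega

/-- The double roots of `T_d - c`. -/
theorem finite_and_card_double_roots {d : ℕ} (hd : 1 ≤ d) (c : ℝ) :
    ∃ S : Finset ℝ, S.card * 2 ≤ d ∧ ∀ z, z ∈ S ↔
      (Polynomial.derivative (chebyshev d)).eval z = 0 ∧ (chebyshev d).eval z = c := by
  classical
  set P : Polynomial ℝ := chebyshev d - Polynomial.C c with hP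
  have hdeg : P.natDegree = d := by rw [hP, Polynomial.natDegree_sub_C, natDegree_chebyshev]
  have hP0 : P ≠ 0 := by rintro h; rw [h] at hdeg; simp at hdeg; omega
  refine ⟨P.roots.toFinset.filter fun z => (Polynomial.derivative (chebyshev d)).eval z = 0,
    ?_, fun z => ?_⟩
  · set S := P.roots.toFinset.filter fun z => (Polynomial.derivative (chebyshev d)).eval z = 0
    -- Each such z is a root of T_d - c of multiplicity at least `2`, and the multiplicities add up
    -- to at most `d`.
    calc S.card * 2 = ∑ z ∈ S, 2 := by simp
      _ ≤ ∑ z ∈ S, P.roots.count z := by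
        refine Finset.sum_le_sum fun z hz => ?_
        simp only [S, Finset.mem_filter, Multiset.mem_toFinset, Polynomial.mem_roots hP0] at hz
        rw [Polynomial.count_roots]
        exact (Polynomial.one_lt_rootMultiplicity_iff_isRoot hP0).2 ⟨hz.1, by
          rw [Polynomial.IsRoot, hP, Polynomial.derivative_sub, Polynomial.derivative_C, sub_zero]
          exact hz.2⟩
      _ ≤ ∑ z ∈ P.roots.toFinset, P.roots.count z :=
        Finset.sum_le_sum_of_subset (Finset.filter_subset _ _)
      _ = P.roots.card := Multiset.toFinset_sum_count_eq _
      _ ≤ d := hdeg ▸ P.card_roots'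
  · simp only [Finset.mem_filter, Multiset.mem_toFinset, Polynomial.mem_roots hP0,
      Polynomial.IsRoot]
    simp [hP, sub_eq_zero, and_comm]

theorem tangencies_finite_and_ncard_le {d : ℕ} (hd : 2 ≤ d) {f : MvPolynomial (Fin 2) ℝ}
    (hf : f.totalDegree ≤ d) :
    (tangencies d f).Finite ∧ (tangencies d f).ncard * 4 ≤ d * (d + 1) * d := by
  classical
  obtain hE := finite_extrema hd hf
  choose S hS hmem using fun c => finite_and_card_double_roots (d := d) (by omega) c
  have heq : tangencies d f =
      ((hE.toFinset.biUnion fun q => (S (eval q f)).image fun z => (q, z) : Finset _) : Set _) := by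
    ext ⟨q, z⟩
    simp [tangencies, hmem, and_comm]
  rw [heq]
  refine ⟨Finset.finite_toSet _, ?_⟩
  rw [Set.ncard_coe_finset]
  have h1 := card_extrema_le hd hf hE.toFinset (by simp)
  calc _ ≤ (∑ q ∈ hE.toFinset, (S (eval q f)).card) * 4 := by
        gcongr
        refine Finset.card_biUnion_le.trans (Finset.sum_le_sum fun q _ => Finset.card_image_le)
    _ = (∑ q ∈ hE.toFinset, (S (eval q f)).card * 2) * 2 := by
        rw [← Finset.sum_mul]; ring
    _ ≤ (∑ q ∈ hE.toFinset, d) * 2 := by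
        gcongr with q _
        exact hS _
    _ = hE.toFinset.card * 2 * d := by rw [Finset.sum_const, smul_eq_mul]; ring
    _ ≤ _ := by gcongr

/-- The extra `4` covers the degrees at most two, where the argument at infinity fails but there is
at most one solitary point. -/
theorem solitaryPoints_finite_and_ncard_le {d : ℕ} {f : MvPolynomial (Fin 2) ℝ}
    (hf : f.totalDegree ≤ d) : (solitaryPoints (equation d f)).Finite ∧
      (solitaryPoints (equation d f)).ncard * 4 ≤ d * (d + 1) * d + 4 := by
  rcases le_or_gt d 2 with h | h
  · have hs := subsingleton_solitaryPoints h f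
    refine ⟨hs.finite, ?_⟩
    have := (Set.ncard_le_one hs.finite).2 fun a ha b hb => hs ha hb
    omega
  · obtain ⟨h1, h2⟩ := tangencies_finite_and_ncard_le (d := d) (by omega) hf
    have hsub := solitaryPoints_subset h hf
    refine ⟨(h1.image _).subset hsub, ?_⟩
    have h3 := Set.ncard_le_ncard hsub (h1.image _)
    have h4 := Set.ncard_image_le (f := chart) h1
    omega

/-! ### Chebyshev critical points and the lower count from signed extrema. -/

/-- At an interior critical point the differential equation (1 - x²)T'' = xT' - d²T leaves sin²θ ·
T'' = -d²T, which determines the sign of the second derivative. -/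
theorem chebyshev_extremum {d k : ℕ} (hk : 0 < k) (hkd : k < d) :
    (Polynomial.derivative (chebyshev d)).eval (Real.cos (k * Real.pi / d)) = 0 ∧
    (chebyshev d).eval (Real.cos (k * Real.pi / d)) = (-1) ^ k ∧
    (Polynomial.derivative (Polynomial.derivative (chebyshev d))).eval
      (Real.cos (k * Real.pi / d)) * (-1) ^ k < 0 := by
  set θ := k * Real.pi / d with hθ
  have hd : (0 : ℝ) < d := by exact_mod_cast hk.trans hkd
  have hdθ : (d : ℝ) * θ = k * Real.pi := by rw [hθ]; field_simp
  have hs : 0 < Real.sin θ := by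
    apply Real.sin_pos_of_pos_of_lt_pi
    · positivity
    · rw [hθ, div_lt_iff₀ hd, mul_comm]
      have : (k : ℝ) < d := by exact_mod_cast hkd
      nlinarith [Real.pi_pos]
  have hT : (chebyshev d).eval (Real.cos θ) = (-1) ^ k := by
    rw [chebyshev, Polynomial.Chebyshev.T_real_cos, Int.cast_natCast, hdθ, Real.cos_nat_mul_pi]
  have hT' : (Polynomial.derivative (chebyshev d)).eval (Real.cos θ) = 0 := by
    rw [chebyshev, Polynomial.Chebyshev.T_derivative_eq_U]
    have := Polynomial.Chebyshev.U_real_cos θ ((d : ℤ) - 1)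
    push_cast at this
    rw [sub_add_cancel, hdθ, Real.sin_nat_mul_pi] at this
    rw [Polynomial.eval_mul, (mul_eq_zero.1 this).resolve_right hs.ne', mul_zero]
  refine ⟨hT', hT, ?_⟩
  have h := congrArg (Polynomial.eval (Real.cos θ))
    (Polynomial.Chebyshev.one_sub_X_sq_mul_derivative_derivative_T_eq_poly_in_T (R := ℝ) (d : ℤ))
  change (_ * Polynomial.derivative (Polynomial.derivative (chebyshev d))).eval _ =
    (_ * Polynomial.derivative (chebyshev d) - _ * chebyshev d).eval _ at h
  simp only [Polynomial.eval_mul, Polynomial.eval_sub, hT', hT, Polynomial.eval_one,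
    Polynomial.eval_pow, Polynomial.eval_X, mul_zero, zero_sub, Int.cast_natCast,
    Polynomial.eval_natCast] at h
  rw [← Real.sin_sq] at h
  have hsq : ((-1 : ℝ) ^ k) ^ 2 = 1 := by rw [← pow_mul, mul_comm, pow_mul]; simp
  have h2 : Real.sin θ ^ 2 * ((Polynomial.derivative (Polynomial.derivative (chebyshev d))).eval
      (Real.cos θ) * (-1) ^ k) = - (d : ℝ) ^ 2 := by
    linear_combination (-1) ^ k * h - (d : ℝ) ^ 2 * hsq
  by_contra hneg
  push Not at hneg
  have := mul_nonneg (sq_nonneg (Real.sin θ)) hneg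
  nlinarith [pow_pos hd 2]

/-- Signed extrema of `f` give solitary points. -/
theorem card_mul_le_ncard_solitaryPoints {d : ℕ} {f : MvPolynomial (Fin 2) ℝ}
    (hf : f.totalDegree ≤ d) {κ : Type*} [Fintype κ] {q : κ → Fin 2 → ℝ}
    (hinj : Function.Injective q) {s : κ → ℝ} (hs : ∀ i, s i = 1 ∨ s i = -1)
    (hq : ∀ i, q i ∈ extrema f) (hval : ∀ i, eval (q i) f = s i)
    (hsign : ∀ i, 0 < eval (q i) (pderiv 0 (pderiv 0 f)) * s i) :
    Fintype.card κ * ((d - 1) / 2) ≤ (solitaryPoints (equation d f)).ncard := by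
  classical
  set m := (d - 1) / 2 with hm
  -- Even indices 2j+2 give the level `1`, odd indices 2j+1 the level `-1`. Both stay strictly
  -- between `0` and `d` for j < (d-1)/2, which avoids the endpoints cos θ = ±1, where the
  -- derivative of T_d does not vanish.
  let k : κ → Fin m → ℕ := fun i j => if s i = 1 then 2 * j + 2 else 2 * j + 1
  have hk : ∀ i j, 0 < k i j ∧ k i j < d ∧ (-1 : ℝ) ^ k i j = s i := by
    intro i j
    have := j.2
    rcases hs i with h | h
    · simp only [k, h, if_true]
      exact ⟨by omega, by omega, by rw [show 2 * (j : ℕ) + 2 = 2 * (j + 1) by ring, pow_mul]; simp⟩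
    · simp only [k, h, show (-1 : ℝ) ≠ 1 by norm_num, if_false]
      exact ⟨by omega, by omega, by rw [pow_add, pow_mul]; simp⟩
  let Φ : κ × Fin m → Projectivization ℝ (Fin 4 → ℝ) := fun a =>
    chart (q a.1, Real.cos (k a.1 a.2 * Real.pi / d))
  have hΦ : Function.Injective Φ := by
    rintro ⟨i, j⟩ ⟨i', j'⟩ h
    have h' := chart_injective h
    rw [Prod.mk.injEq] at h'
    obtain rfl : i = i' := hinj h'.1
    have hd : (0 : ℝ) < d := by exact_mod_cast (hk i j).1.trans (hk i j).2.1
    have hmem : ∀ j, (k i j : ℝ) * Real.pi / d ∈ Set.Icc 0 Real.pi := by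
      intro j
      refine ⟨by positivity, ?_⟩
      rw [div_le_iff₀ hd, mul_comm]
      have : (k i j : ℝ) ≤ d := by exact_mod_cast (hk i j).2.1.le
      nlinarith [Real.pi_pos]
    have h2 := Real.injOn_cos (hmem j) (hmem j') h'.2
    rw [div_left_inj' hd.ne', mul_left_inj' Real.pi_ne_zero, Nat.cast_inj] at h2
    have : (j : ℕ) = j' := by
      simp only [k] at h2
      split_ifs at h2 <;> omega
    rw [Fin.ext this]
  have hsub : Set.range Φ ⊆ solitaryPoints (equation d f) := by
    rintro _ ⟨⟨i, j⟩, rfl⟩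
    obtain ⟨h1, h2, h3⟩ := hk i j
    obtain ⟨t1, t2, t3⟩ := chebyshev_extremum h1 h2
    refine (chart_mem_solitaryPoints (isHomogeneous_homogenize d _)).2
      (isSolitary_affinePoint hf (hq i) t1 (by rw [t2, h3, hval]) ?_)
    rw [h3] at t3
    have hs2 : s i * s i = 1 := by rcases hs i with h | h <;> rw [h] <;> norm_num
    have := mul_neg_of_pos_of_neg (hsign i) t3
    simp only
    nlinarith
  calc _ = (Set.range Φ).ncard := by
        rw [← Set.image_univ, Set.ncard_image_of_injective _ hΦ, Set.ncard_univ,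
          Nat.card_eq_fintype_card, Fintype.card_prod, Fintype.card_fin]
    _ ≤ _ := Set.ncard_le_ncard hsub (solitaryPoints_finite_and_ncard_le hf).1

/-! ### The equation of the curve s ↦ (s^d, (s-1)^d). -/

/-- Coefficients of `(s - 1) ^ d`. -/
noncomputable def powCoeff (d k : ℕ) : ℝ := ((Polynomial.X - 1 : Polynomial ℝ) ^ d).coeff k

theorem sum_powCoeff (d : ℕ) (z : ℂ) :
    ∑ k ∈ Finset.range (d + 1), (powCoeff d k : ℂ) * z ^ k = (z - 1) ^ d := by
  have h := Polynomial.aeval_eq_sum_range' (p := (Polynomial.X - 1 : Polynomial ℝ) ^ d)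
    (n := d + 1) (by
      have := Polynomial.natDegree_pow_le (p := (Polynomial.X - 1 : Polynomial ℝ)) (n := d)
      have h1 : (Polynomial.X - 1 : Polynomial ℝ).natDegree = 1 := Polynomial.natDegree_X_sub_C 1
      rw [h1] at this; omega) z
  rw [map_pow, map_sub, Polynomial.aeval_X, map_one] at h
  rw [h]
  simp [powCoeff, Algebra.smul_def]

/-- The matrix of the multiplication by `(s - 1) ^ d` modulo `s ^ d = x`. -/
noncomputable def mulMatrix (d : ℕ) : Matrix (Fin d) (Fin d) (MvPolynomial (Fin 2) ℝ) :=
  of fun i j => (if (j : ℕ) ≤ i then C (powCoeff d (i - j)) else 0) +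
    (if (i : ℕ) ≤ j then C (powCoeff d (i + d - j)) * X 0 else 0)

/-- The equation of the image of `s ↦ (s ^ d, (s - 1) ^ d)`. -/
noncomputable def powerCurve (d : ℕ) : MvPolynomial (Fin 2) ℝ :=
  (scalar (Fin d) (X 1) - mulMatrix d).det

/-- The relation s^d = x is used at most once when s^j(s-1)^d is reduced for j < d, so every entry
of this d × d matrix has degree at most one. -/
theorem totalDegree_powerCurve_le (d : ℕ) : (powerCurve d).totalDegree ≤ d := by
  rw [powerCurve, det_apply]
  refine totalDegree_finsetSum_le fun σ _ => ?_
  have hneg : ∀ (u : ℤˣ) (F : MvPolynomial (Fin 2) ℝ), (u • F).totalDegree = F.totalDegree := by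
    intro u F
    rcases Int.units_eq_one_or u with rfl | rfl
    · rw [one_smul]
    · rw [Units.neg_smul, one_smul, totalDegree_neg]
  rw [hneg]
  refine (totalDegree_finsetProd _ _).trans ((Finset.sum_le_card_nsmul _ _ 1 fun i _ => ?_).trans
    (by simp))
  rw [Matrix.sub_apply]
  have h1 : ∀ c : ℝ, (C c * X 0 : MvPolynomial (Fin 2) ℝ).totalDegree ≤ 1 := fun c =>
    (totalDegree_mul _ _).trans (by rw [totalDegree_C, totalDegree_X])
  refine (totalDegree_sub _ _).trans (max_le ?_ ?_)
  · rw [scalar_apply, diagonal_apply]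
    split_ifs <;> simp
  · rw [mulMatrix, of_apply]
    refine (totalDegree_add _ _).trans (max_le ?_ ?_) <;> split_ifs
    · simp
    · simp
    · exact h1 _
    · simp

theorem totalDegree_powerCurve (d : ℕ) : (powerCurve d).totalDegree = d := by
  refine le_antisymm (totalDegree_powerCurve_le d) ?_
  -- Setting x = 0 turns the determinant into the characteristic polynomial in y of a real d × d
  -- matrix, which has degree exactly `d`.
  have h := aeval_natDegree_le (powerCurve d) le_rfl
    (![0, Polynomial.X] : Fin 2 → Polynomial ℝ) (n := 1) (by
      intro i; fin_cases i <;> simp)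
  rw [mul_one] at h
  refine le_trans (le_of_eq ?_) h
  set A : Matrix (Fin d) (Fin d) ℝ := (mulMatrix d).map (eval ![0, 0])
  have : aeval (![0, Polynomial.X] : Fin 2 → Polynomial ℝ) (powerCurve d) = A.charpoly := by
    rw [powerCurve, AlgHom.map_det, charpoly]
    congr 1
    ext1 i j
    rw [AlgHom.mapMatrix_apply, map_apply, charmatrix_apply, Matrix.sub_apply, map_sub]
    congr 1
    · rw [scalar_apply, diagonal_apply, diagonal_apply]
      split_ifs <;> simp
    · change _ = Polynomial.C (eval ![0, 0] (mulMatrix d i j))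
      rw [mulMatrix, of_apply]
      split_ifs <;> simp
  rw [this, charpoly_natDegree_eq_dim, Fintype.card_fin]

/-- When z^d equals the value of x, the row (1, z, …, z^(d-1)) is a left eigenvector of the
multiplication matrix, with eigenvalue (z-1)^d. -/
theorem mulMatrix_row (d : ℕ) (z : ℂ) (v : Fin 2 → ℝ) (hz : z ^ d = v 0) (j : Fin d) :
    ∑ i : Fin d, z ^ (i : ℕ) * (eval v (mulMatrix d i j) : ℂ) = (z - 1) ^ d * z ^ (j : ℕ) := by
  have hent : ∀ i : Fin d, z ^ (i : ℕ) * (eval v (mulMatrix d i j) : ℂ) =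
      (fun i : ℕ => (if (j : ℕ) ≤ i then (powCoeff d (i - j) : ℂ) * z ^ i else 0) +
        (if i ≤ (j : ℕ) then (powCoeff d (i + d - j) : ℂ) * z ^ (i + d) else 0)) i := by
    intro i
    simp only [mulMatrix, of_apply, map_add, pow_add, hz]
    split_ifs <;> simp <;> ring
  rw [Finset.sum_congr rfl fun i _ => hent i, Fin.sum_univ_eq_sum_range (fun i : ℕ =>
    (if (j : ℕ) ≤ i then (powCoeff d (i - j) : ℂ) * z ^ i else 0) +
        (if i ≤ (j : ℕ) then (powCoeff d (i + d - j) : ℂ) * z ^ (i + d) else 0)) d,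
    Finset.sum_add_distrib]
  have hj := j.2
  have e1 : ∑ i ∈ Finset.range d, (if (j : ℕ) ≤ i then (powCoeff d (i - j) : ℂ) * z ^ i else 0) =
      ∑ k ∈ Finset.range (d - j), (powCoeff d k : ℂ) * z ^ (k + j) := by
    have hr : Finset.range d = Finset.range ((j : ℕ) + (d - j)) := by congr 1; omega
    rw [hr, Finset.sum_range_add, Finset.sum_eq_zero, zero_add]
    · refine Finset.sum_congr rfl fun k _ => ?_
      rw [if_pos (by omega), Nat.add_sub_cancel_left, add_comm k]
    · intro i hi
      rw [if_neg]; simp at hi; omega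
  have e2 : ∑ i ∈ Finset.range d, (if i ≤ (j : ℕ) then (powCoeff d (i + d - j) : ℂ) * z ^ (i + d)
      else 0) = ∑ i ∈ Finset.range (j + 1), (powCoeff d (d - j + i) : ℂ) * z ^ (d - j + i + j) := by
    rw [← Finset.sum_filter]
    have : (Finset.range d).filter (fun i => i ≤ (j : ℕ)) = Finset.range (j + 1) := by
      ext i; simp; omega
    rw [this]
    refine Finset.sum_congr rfl fun i _ => ?_
    rw [show i + d - j = d - j + i by omega, show i + d = d - j + i + j by omega]
  rw [e1, e2, ← Finset.sum_range_add (fun k => (powCoeff d k : ℂ) * z ^ (k + j)),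
    show d - j + (j + 1) = d + 1 by omega, ← sum_powCoeff, Finset.sum_mul]
  exact Finset.sum_congr rfl fun k _ => by rw [pow_add]; ring

/-- The eigenvector rows for `d` distinct roots form an invertible Vandermonde matrix, which
diagonalizes the multiplication matrix. -/
theorem eval_powerCurve {d : ℕ} {v : Fin 2 → ℝ} {z : Fin d → ℂ} (hz : Function.Injective z)
    (hzv : ∀ k, z k ^ d = v 0) :
    (eval v (powerCurve d) : ℂ) = ∏ k, ((v 1 : ℂ) - (z k - 1) ^ d) := by
  set W := vandermonde z
  have hW : W.det ≠ 0 := det_vandermonde_ne_zero_iff.2 hz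
  set A : Matrix (Fin d) (Fin d) ℂ := of fun i j => (eval v (mulMatrix d i j) : ℂ) with hA
  have h1 : (eval v (powerCurve d) : ℂ) = (scalar (Fin d) (v 1 : ℂ) - A).det := by
    rw [powerCurve]
    have := RingHom.map_det ((Complex.ofRealHom).comp (eval v)) (scalar (Fin d) (X 1) - mulMatrix d)
    rw [RingHom.comp_apply] at this
    refine this.trans ?_
    congr 1
    ext1 i j
    simp only [RingHom.mapMatrix_apply, map_apply, Matrix.sub_apply, scalar_apply, diagonal_apply,
      RingHom.comp_apply, map_sub, hA, of_apply]
    congr 1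
    split_ifs <;> simp
  have h2 : W * (scalar (Fin d) (v 1 : ℂ) - A) =
      diagonal (fun k => (v 1 : ℂ) - (z k - 1) ^ d) * W := by
    ext k j
    rw [mul_sub, Matrix.sub_apply, diagonal_mul, scalar_apply, mul_diagonal, mul_apply]
    have := mulMatrix_row d (z k) v (hzv k) j
    simp only [hA, of_apply, W, vandermonde_apply]
    rw [this]; ring
  have h3 := congrArg det h2
  rw [det_mul, det_mul, det_diagonal, mul_comm] at h3
  rw [h1]
  exact mul_right_cancel₀ hW h3

/-! ### Second-order jets read off from limits along lines. -/

/-- The restriction of a polynomial to the line `s ↦ p + s w`. -/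
noncomputable def lineRestrict {ι : Type*} (p w : ι → ℝ) : MvPolynomial ι ℝ →ₐ[ℝ] Polynomial ℝ :=
  aeval fun i => Polynomial.C (p i) + Polynomial.X * Polynomial.C (w i)

theorem eval_lineRestrict {ι : Type*} (p w : ι → ℝ) (F : MvPolynomial ι ℝ) (s : ℝ) :
    (lineRestrict p w F).eval s = eval (p + s • w) F := by
  induction F using MvPolynomial.induction_on with
  | C a => simp [lineRestrict]
  | add F G hF hG => simp [hF, hG]
  | mul_X F i hF => rw [map_mul, Polynomial.eval_mul, hF]; simp [lineRestrict, mul_comm (w i)]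

theorem derivative_lineRestrict {ι : Type*} [Fintype ι] (p w : ι → ℝ) (F : MvPolynomial ι ℝ) :
    Polynomial.derivative (lineRestrict p w F) =
      ∑ i, Polynomial.C (w i) * lineRestrict p w (pderiv i F) := by
  classical
  induction F using MvPolynomial.induction_on with
  | C a => simp [lineRestrict]
  | add F G hF hG => simp [hF, hG, mul_add, Finset.sum_add_distrib]
  | mul_X F j hF =>
    have h1 : Polynomial.derivative (lineRestrict p w (X j)) = Polynomial.C (w j) := by
      simp [lineRestrict]
    have h2 : ∀ i, Polynomial.C (w i) * lineRestrict p w (pderiv i (F * X j)) =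
        (if i = j then Polynomial.C (w i) * lineRestrict p w F else 0) +
          Polynomial.C (w i) * lineRestrict p w (pderiv i F) * lineRestrict p w (X j) := by
      intro i
      rw [Derivation.leibniz, map_add, smul_eq_mul, smul_eq_mul, map_mul, map_mul, pderiv_X,
        Pi.single_apply]
      by_cases h : i = j
      · subst h; rw [if_pos rfl, if_pos rfl, map_one]; ring
      · rw [if_neg (Ne.symm h), if_neg h, map_zero]; ring
    rw [map_mul, Polynomial.derivative_mul, hF, h1, Finset.sum_congr rfl fun i _ => h2 i,
      Finset.sum_add_distrib, Finset.sum_ite_eq' , if_pos (Finset.mem_univ j), Finset.sum_mul]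
    ring

theorem coeff_of_tendsto_div_sq {U : Polynomial ℝ} {L : ℝ}
    (h : Tendsto (fun s : ℝ => U.eval s / s ^ 2) (𝓝[≠] 0) (𝓝 L)) :
    U.coeff 0 = 0 ∧ U.coeff 1 = 0 ∧ U.coeff 2 = L := by
  have hid : Tendsto (fun s : ℝ => s) (𝓝[≠] 0) (𝓝 0) := tendsto_id.mono_left nhdsWithin_le_nhds
  have hne : ∀ᶠ s : ℝ in 𝓝[≠] 0, s ≠ 0 := eventually_mem_nhdsWithin
  have hP : ∀ P : Polynomial ℝ, Tendsto (fun s : ℝ => P.eval s) (𝓝[≠] 0) (𝓝 (P.coeff 0)) := by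
    intro P
    rw [Polynomial.coeff_zero_eq_eval_zero]
    exact (P.continuous.tendsto 0).mono_left nhdsWithin_le_nhds
  have e0 := U.divX_mul_X_add
  have e1 := U.divX.divX_mul_X_add
  have c1 : U.divX.coeff 0 = U.coeff 1 := by rw [Polynomial.coeff_divX]
  have c2 : U.divX.divX.coeff 0 = U.coeff 2 := by rw [Polynomial.coeff_divX, Polynomial.coeff_divX]
  have h0 : U.coeff 0 = 0 := by
    refine tendsto_nhds_unique (hP U) ?_
    have := h.mul (hid.pow 2)
    simp only [ne_eq, OfNat.ofNat_ne_zero, not_false_eq_true, zero_pow, mul_zero] at this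
    refine this.congr' ?_
    filter_upwards [hne] with s hs
    field_simp
  have v0 : ∀ s, U.eval s = U.divX.eval s * s := fun s => by
    conv_lhs => rw [← e0, h0]
    simp
  have h1 : U.coeff 1 = 0 := by
    rw [← c1]
    refine tendsto_nhds_unique (hP U.divX) ?_
    have := h.mul hid
    rw [mul_zero] at this
    refine this.congr' ?_
    filter_upwards [hne] with s hs
    rw [v0]; field_simp
  have v1 : ∀ s, U.divX.eval s = U.divX.divX.eval s * s := fun s => by
    conv_lhs => rw [← e1, c1, h1]
    simp
  refine ⟨h0, h1, ?_⟩
  rw [← c2]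
  refine tendsto_nhds_unique (hP U.divX.divX) (h.congr' ?_)
  filter_upwards [hne] with s hs
  rw [v0, v1]; field_simp

theorem taylor_of_tendsto {ι : Type*} [Fintype ι] {F : MvPolynomial ι ℝ} {p w : ι → ℝ} {L : ℝ}
    (h : Tendsto (fun s : ℝ => eval (p + s • w) F / s ^ 2) (𝓝[≠] 0) (𝓝 L)) :
    eval p F = 0 ∧ ∑ i, w i * eval p (pderiv i F) = 0 ∧
      ∑ i, w i * ∑ j, w j * eval p (pderiv j (pderiv i F)) = 2 * L := by
  simp only [← eval_lineRestrict] at h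
  obtain ⟨h0, h1, h2⟩ := coeff_of_tendsto_div_sq h
  have hz : ∀ G : MvPolynomial ι ℝ, (lineRestrict p w G).eval 0 = eval p G := fun G => by
    rw [eval_lineRestrict, zero_smul, add_zero]
  refine ⟨?_, ?_, ?_⟩
  · rw [← hz, ← Polynomial.coeff_zero_eq_eval_zero, h0]
  · have := Polynomial.coeff_derivative (lineRestrict p w F) 0
    rw [zero_add, h1, zero_mul, Polynomial.coeff_zero_eq_eval_zero, derivative_lineRestrict,
      Polynomial.eval_finsetSum] at this
    simpa [hz] using this
  · have := Polynomial.coeff_derivative (Polynomial.derivative (lineRestrict p w F)) 0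
    rw [zero_add, Polynomial.coeff_derivative _ 1, h2, Polynomial.coeff_zero_eq_eval_zero,
      derivative_lineRestrict, Polynomial.derivative_sum, Polynomial.eval_finsetSum] at this
    simp only [Polynomial.derivative_C_mul, derivative_lineRestrict, Polynomial.eval_mul,
      Polynomial.eval_C, Polynomial.eval_finsetSum, hz] at this
    rw [this]; norm_num; ring

/-- A polynomial whose second-order behaviour at `p` is a definite form. -/
theorem mem_extrema_of_tendsto {F : MvPolynomial (Fin 2) ℝ} {p : Fin 2 → ℝ} {r : ℝ} (hr : r ≠ 0)
    {N : (Fin 2 → ℝ) → ℝ} (hN : ∀ w, w ≠ 0 → 0 < N w)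
    (h : ∀ w, Tendsto (fun s : ℝ => eval (p + s • w) F / s ^ 2) (𝓝[≠] 0) (𝓝 (r * N w))) :
    eval p F = 0 ∧ p ∈ extrema F := by
  have T := fun w => taylor_of_tendsto (h w)
  have hgrad : ∀ i, eval p (pderiv i F) = 0 := by
    intro i
    simpa [Pi.single_apply] using (T (Pi.single i 1)).2.1
  refine ⟨(T 0).1, hgrad, ?_⟩
  have hcomm : pderiv 1 (pderiv 0 F) = pderiv 0 (pderiv 1 F) := pderiv_comm _ _ _
  have hQ : ∀ x y : ℝ, ![x, y] ≠ 0 → 0 < r * (x ^ 2 * eval p (pderiv 0 (pderiv 0 F)) +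
      2 * (x * y) * eval p (pderiv 0 (pderiv 1 F)) + y ^ 2 * eval p (pderiv 1 (pderiv 1 F))) := by
    intro x y hxy
    have := (T ![x, y]).2.2
    simp only [Fin.sum_univ_two, cons_val_zero, cons_val_one, hcomm] at this
    have e : x ^ 2 * eval p (pderiv 0 (pderiv 0 F)) +
      2 * (x * y) * eval p (pderiv 0 (pderiv 1 F)) + y ^ 2 * eval p (pderiv 1 (pderiv 1 F)) =
        2 * (r * N ![x, y]) := by linear_combination this
    rw [e]
    have := hN _ hxy
    have := mul_pos (mul_self_pos.2 hr) this
    nlinarith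
  rw [hess₂, map_sub, map_mul, map_mul, hcomm]
  set a := eval p (pderiv 0 (pderiv 0 F))
  set b := eval p (pderiv 0 (pderiv 1 F))
  set c := eval p (pderiv 1 (pderiv 1 F))
  have h1 : 0 < r * a := by
    have := hQ 1 0 (by intro h; simpa using congrFun h 0)
    simpa using this
  have ha : a ≠ 0 := by rintro h; simp [h] at h1
  -- On the vector (-b, a) the form takes the value a(ac - b²), so its sign yields that of the
  -- determinant.
  have h2 := hQ (-b) a (by intro h; exact ha (by simpa using congrFun h 1))
  have h3 : r * ((-b) ^ 2 * a + 2 * (-b * a) * b + a ^ 2 * c) = (r * a) * (a * c - b * b) := by ring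
  rw [h3] at h2
  exact pos_of_mul_pos_right h2 h1.le

/-! ### The solitary nodes of the curve. -/

/-- Circles centred at `0` and `1` meet in points symmetric about the real axis. Hence a node
determines its parameter up to conjugation. -/
theorem eq_or_eq_conj_of_norm_eq {u t : ℂ} (h : ‖u‖ = ‖t‖) (h1 : ‖u - 1‖ = ‖t - 1‖) :
    u = t ∨ u = (starRingEnd ℂ) t := by
  have e : Complex.normSq u = Complex.normSq t := by
    rw [Complex.normSq_eq_norm_sq, Complex.normSq_eq_norm_sq, h]
  have e1 : Complex.normSq (u - 1) = Complex.normSq (t - 1) := by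
    rw [Complex.normSq_eq_norm_sq, Complex.normSq_eq_norm_sq, h1]
  rw [Complex.normSq_apply, Complex.normSq_apply] at e e1
  simp only [Complex.sub_re, Complex.sub_im, Complex.one_re, Complex.one_im] at e1
  have hre : u.re = t.re := by linarith
  rw [hre] at e
  rcases mul_self_eq_mul_self_iff.1 (show u.im * u.im = t.im * t.im by linarith) with him | him
  · exact Or.inl (Complex.ext hre him)
  · exact Or.inr (Complex.ext (by simpa using hre) (by simpa using him))

theorem norm_eq_of_pow_eq {u t : ℂ} {d : ℕ} (hd : d ≠ 0) (h : u ^ d = t ^ d) : ‖u‖ = ‖t‖ := by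
  have := congrArg norm h
  rw [norm_pow, norm_pow] at this
  exact (pow_left_inj₀ (norm_nonneg _) (norm_nonneg _) hd).1 this

/-- Vanishing would give a real linear relation between t and t - 1, which are linearly independent
over ℝ because t is not real. This makes the quadratic form at the node definite. -/
theorem branch_deriv_ne_zero {d : ℕ} (hd : d ≠ 0) {t : ℂ} (ht : 0 < t.im) {x y : ℝ}
    (hx : t ^ d = x) (hy : (t - 1) ^ d = y) {w : Fin 2 → ℝ} (hw : w ≠ 0) :
    (w 1 : ℂ) - (t - 1) ^ (d - 1) * t * ((w 0 / x : ℝ) : ℂ) ≠ 0 := by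
  intro h
  have ht0 : t ≠ 0 := by rintro rfl; simp at ht
  have ht1 : t - 1 ≠ 0 := by
    intro h
    have := congrArg Complex.im h
    simp at this; exact ht.ne' this
  have hx0 : x ≠ 0 := by
    rintro rfl
    exact ht0 (pow_eq_zero_iff hd |>.1 (by simpa using hx))
  set c : ℝ := w 0 / x with hc
  have hy' : (t - 1) ^ (d - 1) * (t - 1) = y := by rw [← hy, ← pow_succ, Nat.sub_add_cancel (by omega)]
  have e : (w 1 : ℂ) * (t - 1) = (y * c : ℝ) * t := by
    push_cast
    linear_combination (t - 1) * h + t * c * hy'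
  have him := congrArg Complex.im e
  have hre := congrArg Complex.re e
  rw [Complex.re_ofReal_mul, Complex.re_ofReal_mul] at hre
  rw [Complex.im_ofReal_mul, Complex.im_ofReal_mul] at him
  simp only [Complex.sub_re, Complex.sub_im, Complex.one_re, Complex.one_im, sub_zero] at him hre
  have h1 : w 1 = y * c := mul_right_cancel₀ ht.ne' him
  have h2 : w 1 = 0 := by rw [← h1] at hre; linarith
  have hy0 : y ≠ 0 := by
    rintro rfl
    exact ht1 (pow_eq_zero_iff hd |>.1 (by simpa using hy))
  have h3 : c = 0 := by
    have : y * c = 0 := by rw [← h1, h2]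
    exact (mul_eq_zero.1 this).resolve_left hy0
  have h4 : w 0 = 0 := by
    rw [hc, div_eq_zero_iff] at h3
    exact h3.resolve_right hx0
  apply hw
  ext i; fin_cases i
  exacts [h4, h2]

/-- Near the node the equation is a product over the `d` roots of the x-coordinate. The branches
through t and t̄ contribute conjugate factors, hence a squared modulus of order s². The remaining
factors tend to a nonzero real constant `r`. -/
theorem exists_tendsto_powerCurve {d : ℕ} (hd : d ≠ 0) {t : ℂ} (ht : 0 < t.im) {x y : ℝ}
    (hx : t ^ d = x) (hy : (t - 1) ^ d = y) : ∃ r : ℝ, r ≠ 0 ∧ ∀ w : Fin 2 → ℝ,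
      Tendsto (fun s : ℝ => eval (![x, y] + s • w) (powerCurve d) / s ^ 2) (𝓝[≠] 0)
        (𝓝 (r * Complex.normSq
          ((w 1 : ℂ) - (t - 1) ^ (d - 1) * t * ((w 0 / x : ℝ) : ℂ)))) := by
  have : NeZero d := ⟨hd⟩
  have ht0 : t ≠ 0 := by rintro rfl; simp at ht
  have hx0 : x ≠ 0 := by
    rintro rfl
    exact ht0 (pow_eq_zero_iff hd |>.1 (by simpa using hx))
  obtain ⟨ω, hω⟩ : ∃ ω : ℂ, IsPrimitiveRoot ω d := ⟨_, Complex.isPrimitiveRoot_exp d hd⟩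
  have hω0 : ω ≠ 0 := hω.ne_zero hd
  have hinj : Function.Injective fun k : Fin d => t * ω ^ (k : ℕ) := by
    intro k l h
    exact Fin.ext (hω.pow_inj k.2 l.2 (mul_left_cancel₀ ht0 h))
  obtain ⟨k₁, hk₁⟩ : ∃ k₁ : Fin d, t * ω ^ (k₁ : ℕ) = (starRingEnd ℂ) t := by
    have : ((starRingEnd ℂ) t / t) ^ d = 1 := by
      rw [div_pow, ← map_pow, hx, Complex.conj_ofReal, div_self]
      exact_mod_cast hx0
    obtain ⟨i, hi, h⟩ := hω.eq_pow_of_pow_eq_one this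
    exact ⟨⟨i, hi⟩, by rw [h]; field_simp⟩
  have hk₁0 : k₁ ≠ 0 := by
    rintro rfl
    rw [Fin.val_zero, pow_zero, mul_one] at hk₁
    have := congrArg Complex.im hk₁
    simp at this; linarith
  set S : Finset (Fin d) := (Finset.univ.erase 0).erase k₁ with hS
  -- Multiplying the roots at the node by this real factor gives the roots of the displaced
  -- coordinate x + s·w₀.
  set ρ : (Fin 2 → ℝ) → ℝ → ℝ := fun w s => (1 + s * (w 0 / x)) ^ ((d : ℝ)⁻¹) with hρ
  set R : (Fin 2 → ℝ) → ℝ → ℂ := fun w s =>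
    ∏ k ∈ S, (((y + s * w 1 : ℝ) : ℂ) - (ρ w s * (t * ω ^ (k : ℕ)) - 1) ^ d) with hR
  set φ : (Fin 2 → ℝ) → ℝ → ℂ := fun w s =>
    ((y + s * w 1 : ℝ) : ℂ) - (ρ w s * t - 1) ^ d with hφ
  set R₀ : ℂ := ∏ k ∈ S, ((y : ℂ) - (t * ω ^ (k : ℕ) - 1) ^ d) with hR₀
  have hρ0 : ∀ w, ρ w 0 = 1 := fun w => by simp [hρ]
  have hρd : ∀ w, HasDerivAt (ρ w) ((w 0 / x) * (d : ℝ)⁻¹) 0 := by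
    intro w
    have h1 : HasDerivAt (fun s : ℝ => 1 + s * (w 0 / x)) (w 0 / x) 0 := by
      simpa using ((hasDerivAt_id (0 : ℝ)).mul_const (w 0 / x)).const_add 1
    have := h1.rpow_const (p := (d : ℝ)⁻¹) (Or.inl (by simp))
    simpa using this
  have hRlim : ∀ w, Tendsto (R w) (𝓝[≠] 0) (𝓝 R₀) := by
    intro w
    have hc : ContinuousAt (R w) 0 := by
      have := (hρd w).continuousAt
      simp only [hR]
      fun_prop
    have h0 : R w 0 = R₀ := by simp [hR, hR₀, hρ0]
    rw [← h0]
    exact hc.tendsto.mono_left nhdsWithin_le_nhds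
  have hφlim : ∀ w, Tendsto (fun s : ℝ => φ w s / s) (𝓝[≠] 0)
      (𝓝 ((w 1 : ℂ) - (t - 1) ^ (d - 1) * t * ((w 0 / x : ℝ) : ℂ))) := by
    intro w
    have h1 : HasDerivAt (fun s : ℝ => ((y + s * w 1 : ℝ) : ℂ)) (w 1 : ℂ) 0 := by
      have : HasDerivAt (fun s : ℝ => y + s * w 1) (w 1) 0 := by
        simpa using ((hasDerivAt_id (0 : ℝ)).mul_const (w 1)).const_add y
      exact this.ofReal_comp
    have h2 := (((hρd w).ofReal_comp.mul_const t).sub_const 1).pow d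
    have h3 := h1.sub h2
    have hd' : (d : ℂ) ≠ 0 := by exact_mod_cast hd
    have h4 : HasDerivAt (φ w) ((w 1 : ℂ) - (t - 1) ^ (d - 1) * t * ((w 0 / x : ℝ) : ℂ)) 0 := by
      refine h3.congr_deriv ?_
      rw [hρ0]
      push_cast
      field_simp
    have h5 := h4.tendsto_slope_zero
    have h0 : φ w 0 = 0 := by simp [hφ, hρ0, hy]
    refine h5.congr fun s => ?_
    rw [zero_add, h0, sub_zero, Complex.real_smul, Complex.ofReal_inv, div_eq_inv_mul]
  have hfac : ∀ w, ∀ᶠ s in 𝓝[≠] (0 : ℝ),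
      ((eval (![x, y] + s • w) (powerCurve d) / s ^ 2 : ℝ) : ℂ) =
        (Complex.normSq (φ w s / s) : ℂ) * R w s := by
    intro w
    have hpos : ∀ᶠ s in 𝓝 (0 : ℝ), 0 < 1 + s * (w 0 / x) := by
      have : ContinuousAt (fun s : ℝ => 1 + s * (w 0 / x)) 0 := by fun_prop
      exact this.eventually (lt_mem_nhds (by simp))
    filter_upwards [nhdsWithin_le_nhds hpos, eventually_mem_nhdsWithin] with s hs hs0
    have hs0' : (s : ℂ) ≠ 0 := by exact_mod_cast hs0
    have hρpos : 0 < ρ w s := Real.rpow_pos_of_pos hs _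
    have hρpow : ρ w s ^ d = 1 + s * (w 0 / x) := Real.rpow_inv_natCast_pow hs.le hd
    have hzinj : Function.Injective fun k : Fin d => (ρ w s : ℂ) * (t * ω ^ (k : ℕ)) := by
      intro k l h
      exact hinj (mul_left_cancel₀ (by exact_mod_cast hρpos.ne') h)
    have hz : ∀ k : Fin d, ((ρ w s : ℂ) * (t * ω ^ (k : ℕ))) ^ d =
        ((![x, y] + s • w) 0 : ℝ) := by
      intro k
      rw [mul_pow, mul_pow, ← pow_mul, mul_comm (k : ℕ), pow_mul, hω.pow_eq_one, one_pow, mul_one,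
        hx, ← Complex.ofReal_pow, hρpow, ← Complex.ofReal_mul]
      congr 1
      simp
      field_simp
    have hev := eval_powerCurve hzinj hz
    have hv1 : (![x, y] + s • w) 1 = y + s * w 1 := by simp
    rw [hv1, ← Finset.mul_prod_erase _ _ (Finset.mem_univ (0 : Fin d)),
      ← Finset.mul_prod_erase _ _ (Finset.mem_erase.2 ⟨hk₁0, Finset.mem_univ k₁⟩)] at hev
    have hconj : ((y + s * w 1 : ℝ) : ℂ) - ((ρ w s : ℂ) * (t * ω ^ (k₁ : ℕ)) - 1) ^ d =
        (starRingEnd ℂ) (φ w s) := by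
      rw [hk₁]
      simp [hφ, Complex.conj_ofReal]
    have hzero : ((y + s * w 1 : ℝ) : ℂ) - ((ρ w s : ℂ) * (t * ω ^ ((0 : Fin d) : ℕ)) - 1) ^ d =
        φ w s := by simp [hφ]
    rw [hconj, hzero, ← mul_assoc, Complex.mul_conj] at hev
    change _ = _ * R w s at hev
    push_cast [map_div₀]
    rw [hev, Complex.normSq_ofReal]
    push_cast
    field_simp
  have hlim : ∀ w, Tendsto (fun s : ℝ => (Complex.normSq (φ w s / s) : ℂ) * R w s) (𝓝[≠] 0)
      (𝓝 ((Complex.normSq ((w 1 : ℂ) - (t - 1) ^ (d - 1) * t * ((w 0 / x : ℝ) : ℂ)) : ℂ) * R₀)) :=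
    fun w => (((Complex.continuous_ofReal.comp Complex.continuous_normSq).tendsto _).comp
      (hφlim w)).mul (hRlim w)
  have hlim' : ∀ w, Tendsto (fun s : ℝ => ((eval (![x, y] + s • w) (powerCurve d) / s ^ 2 : ℝ) : ℂ))
      (𝓝[≠] 0)
      (𝓝 ((Complex.normSq ((w 1 : ℂ) - (t - 1) ^ (d - 1) * t * ((w 0 / x : ℝ) : ℂ)) : ℂ) * R₀)) :=
    fun w => (hlim w).congr' (by filter_upwards [hfac w] with s hs using hs.symm)
  have hR₀0 : R₀ ≠ 0 := by
    rw [hR₀, Finset.prod_ne_zero_iff]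
    intro k hk h
    rw [hS, Finset.mem_erase, Finset.mem_erase] at hk
    rw [sub_eq_zero, ← hy] at h
    have n1 := norm_eq_of_pow_eq hd h
    have n2 : ‖t * ω ^ (k : ℕ)‖ = ‖t‖ := by
      rw [norm_mul, norm_pow, hω.norm'_eq_one hd, one_pow, mul_one]
    rcases eq_or_eq_conj_of_norm_eq n2 n1.symm with h' | h'
    · exact hk.2.1 (hinj (by simpa using h'))
    · exact hk.1 (hinj (by simpa [hk₁] using h'))
  -- In the direction (0, 1) the squared modulus is `1`, so the limit of real quotients is R₀
  -- itself.
  have him : R₀.im = 0 := by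
    have h1 := (Complex.continuous_im.tendsto _).comp (hlim' ![0, 1])
    simp only [Function.comp_def, Complex.ofReal_im] at h1
    have h2 := tendsto_nhds_unique h1 tendsto_const_nhds
    simpa using h2
  refine ⟨R₀.re, fun h => hR₀0 (Complex.ext h him), fun w => ?_⟩
  have h1 := (Complex.continuous_re.tendsto _).comp (hlim' w)
  simp only [Function.comp_def, Complex.ofReal_re, Complex.re_ofReal_mul] at h1
  rwa [mul_comm] at h1

theorem mem_extrema_powerCurve {d : ℕ} (hd : d ≠ 0) {t : ℂ} (ht : 0 < t.im) {x y : ℝ}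
    (hx : t ^ d = x) (hy : (t - 1) ^ d = y) :
    eval ![x, y] (powerCurve d) = 0 ∧ ![x, y] ∈ extrema (powerCurve d) := by
  obtain ⟨r, hr, h⟩ := exists_tendsto_powerCurve hd ht hx hy
  exact mem_extrema_of_tendsto hr
    (fun w hw => Complex.normSq_pos.2 (branch_deriv_ne_zero hd ht hx hy hw)) h

/-! ### Position of the nodes and interpolation at them. -/

/-- The pairs `(s, a)` with `a ≤ s < m`. -/
abbrev NodeIndex (m : ℕ) := (s : Fin m) × Fin (s + 1)

/-- The intersection of the rays with directions `α` at `0` and `β` at `1`. -/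
noncomputable def rayPoint (α β : ℝ) : ℂ :=
  (Real.sin β / Real.sin (β - α) : ℝ) * (Real.cos α + Real.sin α * Complex.I)

/-- The law of sines in the triangle with vertices `0`, `1` and the intersection point. -/
theorem rayPoint_sub_one {α β : ℝ} (h : Real.sin (β - α) ≠ 0) :
    rayPoint α β - 1 =
      (Real.sin α / Real.sin (β - α) : ℝ) * (Real.cos β + Real.sin β * Complex.I) := by
  have hs := Real.sin_sub β α
  rw [rayPoint]
  generalize Real.sin (β - α) = S at *
  generalize Real.sin β = sb, Real.sin α = sa, Real.cos β = cb, Real.cos α = ca at *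
  apply Complex.ext
  · simp
    field_simp
    linear_combination -hs
  · simp
    field_simp

theorem ofReal_mul_expI_pow_im {d k : ℕ} (hd : d ≠ 0) (r : ℝ) :
    ∃ x : ℝ, ((r : ℂ) * ((Real.cos (k * Real.pi / d) : ℝ) +
      (Real.sin (k * Real.pi / d) : ℝ) * Complex.I)) ^ d = x := by
  refine ⟨r ^ d * (-1) ^ k, ?_⟩
  rw [mul_pow, Complex.ofReal_cos, Complex.ofReal_sin, Complex.cos_add_sin_mul_I_pow,
    ← Complex.ofReal_natCast, ← Complex.ofReal_mul, ← Complex.ofReal_cos, ← Complex.ofReal_sin,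
    show (d : ℝ) * (k * Real.pi / d) = k * Real.pi by field_simp, Real.cos_nat_mul_pi,
    Real.sin_nat_mul_pi]
  simp

theorem rayPoint_injective {α β α' β' : ℝ} (hα : 0 < α) (hαβ : α < β) (hβ : β < Real.pi)
    (hα' : 0 < α') (hαβ' : α' < β') (hβ' : β' < Real.pi) (h : rayPoint α β = rayPoint α' β') :
    α = α' ∧ β = β' := by
  have s1 := Real.sin_pos_of_pos_of_lt_pi hα (hαβ.trans hβ)
  have s1' := Real.sin_pos_of_pos_of_lt_pi hα' (hαβ'.trans hβ')
  have s2 := Real.sin_pos_of_pos_of_lt_pi (hα.trans hαβ) hβ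
  have s2' := Real.sin_pos_of_pos_of_lt_pi (hα'.trans hαβ') hβ'
  have s3 := Real.sin_pos_of_pos_of_lt_pi (sub_pos.2 hαβ) (by linarith)
  have s3' := Real.sin_pos_of_pos_of_lt_pi (sub_pos.2 hαβ') (by linarith)
  constructor
  · have e := congrArg Complex.arg h
    rw [rayPoint, rayPoint, Complex.ofReal_cos, Complex.ofReal_sin, Complex.ofReal_cos,
      Complex.ofReal_sin, Complex.arg_mul_cos_add_sin_mul_I (by positivity) ⟨by linarith, by linarith⟩,
      Complex.arg_mul_cos_add_sin_mul_I (by positivity) ⟨by linarith, by linarith⟩] at e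
    exact e
  · have e := congrArg (fun t => Complex.arg (t - 1)) h
    beta_reduce at e
    rw [rayPoint_sub_one s3.ne', rayPoint_sub_one s3'.ne', Complex.ofReal_cos, Complex.ofReal_sin,
      Complex.ofReal_cos, Complex.ofReal_sin,
      Complex.arg_mul_cos_add_sin_mul_I (by positivity) ⟨by linarith, by linarith⟩,
      Complex.arg_mul_cos_add_sin_mul_I (by positivity) ⟨by linarith, by linarith⟩] at e
    exact e

/-- The `m (m + 1) / 2` points `s` of the upper half plane at which `s ^ (m + 2)` and
`(s - 1) ^ (m + 2)` are real. -/
theorem exists_node_params (m : ℕ) : ∃ t : NodeIndex m → ℂ,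
    Function.Injective t ∧ (∀ b, 0 < (t b).im) ∧ (∀ b, ∃ x : ℝ, t b ^ (m + 2) = x) ∧
      ∀ b, ∃ y : ℝ, (t b - 1) ^ (m + 2) = y := by
  have hd : m + 2 ≠ 0 := by omega
  have hd' : (0 : ℝ) < ((m + 2 : ℕ) : ℝ) := by positivity
  -- The angles at `0` and `1` are kπ/d and lπ/d with d = m+2 and 1 ≤ k < l ≤ d-1, where k = a+1 and
  -- l = s+2. This gives one point for each of the m(m+1)/2 pairs.
  let α : NodeIndex m → ℝ := fun b => ((b.2 + 1 : ℕ) : ℝ) * Real.pi / (m + 2 : ℕ)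
  let β : NodeIndex m → ℝ := fun b => ((b.1 + 2 : ℕ) : ℝ) * Real.pi / (m + 2 : ℕ)
  have hα : ∀ b, 0 < α b := fun b => by
    have := Real.pi_pos
    have : (0 : ℝ) < ((b.2 + 1 : ℕ) : ℝ) := by positivity
    positivity
  have hαβ : ∀ b, α b < β b := fun b => by
    have h1 : ((b.2 + 1 : ℕ) : ℝ) < ((b.1 + 2 : ℕ) : ℝ) := by
      have := b.2.2
      exact_mod_cast (by omega : (b.2 : ℕ) + 1 < b.1 + 2)
    have := Real.pi_pos
    simp only [α, β]
    gcongr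
  have hβ : ∀ b, β b < Real.pi := fun b => by
    have h1 : ((b.1 + 2 : ℕ) : ℝ) < ((m + 2 : ℕ) : ℝ) := by
      have := b.1.2
      exact_mod_cast (by omega : (b.1 : ℕ) + 2 < m + 2)
    simp only [β]
    rw [div_lt_iff₀ hd', mul_comm]
    exact mul_lt_mul_of_pos_left h1 Real.pi_pos
  have s3 : ∀ b, 0 < Real.sin (β b - α b) := fun b =>
    Real.sin_pos_of_pos_of_lt_pi (sub_pos.2 (hαβ b)) (by linarith [hα b, hβ b])
  refine ⟨fun b => rayPoint (α b) (β b), ?_, fun b => ?_, fun b => ?_, fun b => ?_⟩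
  · intro b b' h
    obtain ⟨e1, e2⟩ := rayPoint_injective (hα b) (hαβ b) (hβ b) (hα b') (hαβ b') (hβ b') h
    simp only [α, β] at e1 e2
    rw [div_left_inj' hd'.ne', mul_left_inj' Real.pi_ne_zero, Nat.cast_inj] at e1 e2
    obtain ⟨s, a⟩ := b
    obtain ⟨s', a'⟩ := b'
    simp only at e1 e2
    obtain rfl : s = s' := Fin.ext (by omega)
    obtain rfl : a = a' := Fin.ext (by omega)
    rfl
  · have h1 := Real.sin_pos_of_pos_of_lt_pi (hα b) ((hαβ b).trans (hβ b))
    have h2 := Real.sin_pos_of_pos_of_lt_pi ((hα b).trans (hαβ b)) (hβ b)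
    have h3 := s3 b
    simp only [rayPoint, Complex.im_ofReal_mul]
    simp
    simp only [← Complex.ofReal_sin, ← Complex.ofReal_cos, Complex.ofReal_re, Complex.ofReal_im]
    positivity
  · exact ofReal_mul_expI_pow_im hd _
  · rw [rayPoint_sub_one (s3 b).ne']
    exact ofReal_mul_expI_pow_im hd _

theorem linear_pow_injective {d : ℕ} (hd : d ≠ 0) {u v : ℂ}
    (h : (Polynomial.C u * Polynomial.X - 1) ^ d = (Polynomial.C v * Polynomial.X - 1) ^ d) :
    u = v := by
  have := congrArg (fun P => (Polynomial.derivative P).eval 0) h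
  simpa [Polynomial.derivative_pow, hd] using this

/-- Linear independence of the monomials in `s ^ d`, `(s - 1) ^ d` of degree less than `d`. -/
theorem coeff_eq_zero_of_sum_eq_zero {m d : ℕ} (hmd : m ≤ d) (hd : d ≠ 0)
    {c : NodeIndex m → ℂ}
    (h : ∑ b, Polynomial.C (c b) * (Polynomial.X ^ (d * b.2) *
      (Polynomial.X - 1) ^ (d * (b.1 - b.2))) = 0) : c = 0 := by
  obtain ⟨ω, hω⟩ : ∃ ω : ℂ, IsPrimitiveRoot ω d := ⟨_, Complex.isPrimitiveRoot_exp d hd⟩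
  -- The relation says that `P`, a polynomial in Y over ℂ[s], vanishes at Y = (s-1)^d. Substituting
  -- ω^k s for s fixes s^d, hence the coefficients of `P`, so `P` has the `d` distinct roots (ω^k s
  -- - 1)^d although its degree in Y is below `d`.
  set P : Polynomial (Polynomial ℂ) := ∑ b, Polynomial.C (Polynomial.C (c b) *
    Polynomial.X ^ (d * b.2)) * Polynomial.X ^ ((b.1 : ℕ) - b.2) with hP
  have hdeg : P.natDegree < d := by
    refine lt_of_le_of_lt (Polynomial.natDegree_sum_le_of_forall_le _ _ (n := d - 1)
      fun b _ => ?_) (by omega)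
    refine (Polynomial.natDegree_C_mul_X_pow_le _ _).trans ?_
    have := b.1.2
    omega
  have hP0 : P = 0 := by
    refine Polynomial.eq_zero_of_natDegree_lt_card_of_eval_eq_zero P
      (f := fun k : Fin d => (Polynomial.C (ω ^ (k : ℕ)) * Polynomial.X - 1) ^ d) ?_ ?_ (by simpa)
    · intro k l hkl
      exact Fin.ext (hω.pow_inj k.2 l.2 (linear_pow_injective hd hkl))
    · intro k
      have h2 := congrArg (fun Q => Q.comp (Polynomial.C (ω ^ (k : ℕ)) * Polynomial.X)) h
      simp only [Polynomial.sum_comp, Polynomial.mul_comp, Polynomial.C_comp,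
        Polynomial.pow_comp, Polynomial.X_comp, Polynomial.sub_comp, Polynomial.one_comp,
        Polynomial.zero_comp] at h2
      rw [hP, Polynomial.eval_finsetSum, ← h2]
      refine Finset.sum_congr rfl fun b _ => ?_
      rw [Polynomial.eval_mul, Polynomial.eval_C, Polynomial.eval_pow, Polynomial.eval_X, ← pow_mul,
        mul_pow, ← Polynomial.C_pow, ← pow_mul, mul_comm (k : ℕ), mul_assoc d, pow_mul ω,
        hω.pow_eq_one, one_pow, Polynomial.C_1, one_mul, mul_assoc]
  ext ⟨s, a⟩
  have h3 := congrArg (fun Q => (Polynomial.coeff (Polynomial.coeff Q (s - a)) (d * a))) hP0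
  simp only [hP, Polynomial.finsetSum_coeff, Polynomial.coeff_C_mul, Polynomial.coeff_X_pow,
    Polynomial.coeff_zero, mul_ite, mul_one, mul_zero] at h3
  rw [Finset.sum_eq_single ⟨s, a⟩] at h3
  · simpa using h3
  · rintro ⟨s', a'⟩ - hne
    split_ifs with h1
    · rw [Polynomial.coeff_C_mul, Polynomial.coeff_X_pow, if_neg, mul_zero]
      intro h2
      have h2' := Nat.eq_of_mul_eq_mul_left (Nat.pos_of_ne_zero hd) h2
      apply hne
      have := a.2
      have := a'.2
      simp only at h1 h2'
      obtain rfl : s = s' := Fin.ext (by omega)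
      obtain rfl : a = a' := Fin.ext (by omega)
      rfl
    · simp
  · simp

/-- Interpolation at the nodes by polynomials of degree less than `m`. -/
theorem exists_interpolation {m : ℕ} {t : NodeIndex m → ℂ}
    (hinj : Function.Injective t) (him : ∀ b, 0 < (t b).im)
    {x y : NodeIndex m → ℝ} (hx : ∀ b, t b ^ (m + 2) = x b)
    (hy : ∀ b, (t b - 1) ^ (m + 2) = y b) :
    ∃ g : NodeIndex m → MvPolynomial (Fin 2) ℝ,
      (∀ j, (g j).totalDegree ≤ m) ∧ ∀ i j, eval ![x i, y i] (g j) = if i = j then 1 else 0 := by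
  classical
  let L : (NodeIndex m → ℝ) →ₗ[ℝ] (NodeIndex m → ℝ) :=
    { toFun := fun c i => ∑ b : NodeIndex m, c b * (x i ^ (b.2 : ℕ) * y i ^ ((b.1 : ℕ) - b.2))
      map_add' := fun c c' => by ext i; simp [add_mul, Finset.sum_add_distrib]
      map_smul' := fun r c => by ext i; simp [Finset.mul_sum, mul_assoc] }
  have hL : Function.Injective L := by
    rw [injective_iff_map_eq_zero]
    intro c hc
    have hc' : ∀ i, ∑ b : NodeIndex m, (c b : ℂ) * ((x i : ℂ) ^ (b.2 : ℕ) * (y i : ℂ) ^ ((b.1 : ℕ) - b.2)) = 0 := by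
      intro i
      have := congrFun hc i
      simp only [L, LinearMap.coe_mk, AddHom.coe_mk, Pi.zero_apply] at this
      exact_mod_cast this
    rcases Nat.eq_zero_or_pos m with rfl | hm
    · exact funext fun b => b.1.elim0
    set h : Polynomial ℂ := ∑ b : NodeIndex m, Polynomial.C (c b : ℂ) * (Polynomial.X ^ ((m + 2) * b.2) *
      (Polynomial.X - 1) ^ ((m + 2) * (b.1 - b.2))) with hh
    have hroot : ∀ (i : NodeIndex m) (u : ℂ), u ^ (m + 2) = x i → (u - 1) ^ (m + 2) = y i → h.eval u = 0 := by
      intro i u hu hu'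
      rw [← hc' i, hh, Polynomial.eval_finsetSum]
      refine Finset.sum_congr rfl fun b _ => ?_
      simp [pow_mul, hu, hu']
    -- The degree of `h` is at most (m+2)(m-1) = m(m+1) - 2, but `h` vanishes at the m(m+1) points t
    -- and t̄.
    have h0 : h = 0 := by
      let F : NodeIndex m ⊕ NodeIndex m → ℂ := Sum.elim t fun b => (starRingEnd ℂ) (t b)
      have hF : Function.Injective F := by
        have hne : ∀ a b, t a ≠ (starRingEnd ℂ) (t b) := by
          intro a b hab
          have := congrArg Complex.im hab
          rw [Complex.conj_im] at this
          linarith [him a, him b]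
        rintro (a | a) (b | b) hab
        · exact congrArg _ (hinj hab)
        · exact absurd hab (hne a b)
        · exact absurd hab.symm (hne b a)
        · exact congrArg _ (hinj ((starRingEnd ℂ).injective hab))
      refine Polynomial.eq_zero_of_natDegree_lt_card_of_eval_eq_zero h hF ?_ ?_
      · rintro (b | b)
        · exact hroot b _ (hx b) (hy b)
        · refine hroot b _ ?_ ?_
          · simp only [F, Sum.elim_inr]
            rw [← map_pow, hx, Complex.conj_ofReal]
          · simp only [F, Sum.elim_inr]
            rw [← map_one (starRingEnd ℂ), ← map_sub, ← map_pow, hy, Complex.conj_ofReal]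
      · have hcard : Fintype.card (NodeIndex m ⊕ NodeIndex m) = m * (m + 1) := by
          rw [Fintype.card_sum, ← mul_two, card_triangle]
        rw [hcard]
        refine lt_of_le_of_lt (Polynomial.natDegree_sum_le_of_forall_le _ _
          (n := (m + 2) * (m - 1)) fun b _ => ?_) ?_
        · refine (Polynomial.natDegree_C_mul_le _ _).trans ?_
          refine Polynomial.natDegree_mul_le.trans ?_
          rw [Polynomial.natDegree_X_pow]
          refine (Nat.add_le_add_left (Polynomial.natDegree_pow_le.trans
            (Nat.mul_le_mul_left _ (Polynomial.natDegree_X_sub_C_le (1 : ℂ)))) _).trans ?_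
          rw [mul_one, ← Nat.mul_add]
          have := b.1.2
          have := b.2.2
          exact Nat.mul_le_mul_left _ (by omega)
        · obtain ⟨k, rfl⟩ : ∃ k, m = k + 1 := ⟨m - 1, by omega⟩
          simp only [Nat.add_sub_cancel]
          nlinarith
    have := coeff_eq_zero_of_sum_eq_zero (by omega) (by omega) h0
    ext b
    simpa using congrFun this b
  have hsurj : Function.Surjective L := LinearMap.surjective_of_injective hL
  choose c hc using fun j : NodeIndex m => hsurj (Pi.single j 1)
  refine ⟨fun j => ∑ b : NodeIndex m, C (c j b) * (X 0 ^ (b.2 : ℕ) * X 1 ^ ((b.1 : ℕ) - b.2)), fun j => ?_,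
    fun i j => ?_⟩
  · refine totalDegree_finsetSum_le fun b _ => ?_
    refine (totalDegree_mul _ _).trans ?_
    rw [totalDegree_C, zero_add]
    refine (totalDegree_mul _ _).trans ?_
    rw [totalDegree_X_pow, totalDegree_X_pow]
    have := b.1.2
    have := b.2.2
    omega
  · have := congrFun (hc j) i
    simp only [L, LinearMap.coe_mk, AddHom.coe_mk, Pi.single_apply] at this
    simp [this]

/-! ### Independent perturbation of the critical values. -/

/-- The member of a linear family of polynomials with parameters `a`. -/
noncomputable def perturb {κ : Type*} [Fintype κ] (f : MvPolynomial (Fin 2) ℝ)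
    (g : κ → MvPolynomial (Fin 2) ℝ) (a : κ → ℝ) : MvPolynomial (Fin 2) ℝ :=
  f + ∑ j, C (a j) * g j

section

variable {κ : Type*} [Fintype κ] (f : MvPolynomial (Fin 2) ℝ) (g : κ → MvPolynomial (Fin 2) ℝ)

theorem eval_perturb (a : κ → ℝ) (q : Fin 2 → ℝ) :
    eval q (perturb f g a) = eval q f + ∑ j, a j * eval q (g j) := by
  simp [perturb]

theorem perturb_zero : perturb f g 0 = f := by
  simp [perturb]

theorem pderiv_perturb (i : Fin 2) (a : κ → ℝ) :
    pderiv i (perturb f g a) = perturb (pderiv i f) (fun j => pderiv i (g j)) a := by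
  simp [perturb, pderiv_C_mul]

theorem totalDegree_perturb {d : ℕ} (hf : f.totalDegree = d) (hd : d ≠ 0)
    (hg : ∀ j, (g j).totalDegree < d) (a : κ → ℝ) : (perturb f g a).totalDegree = d := by
  rw [perturb, totalDegree_add_eq_left_of_totalDegree_lt, hf]
  rw [hf]
  refine lt_of_le_of_lt (totalDegree_finsetSum_le (d := d - 1) fun j _ => ?_) (by omega)
  have h1 := totalDegree_mul (C (a j)) (g j)
  have h2 := hg j
  rw [totalDegree_C] at h1
  omega

theorem continuous_eval_perturb (i : κ) :
    Continuous fun w : (κ → ℝ) × (κ → Fin 2 → ℝ) => eval (w.2 i) (perturb f g w.1) := by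
  simp only [eval_perturb]
  have : ∀ F : MvPolynomial (Fin 2) ℝ, Continuous fun w : (κ → ℝ) × (κ → Fin 2 → ℝ) =>
      eval (w.2 i) F := fun F => (MvPolynomial.continuous_eval F).comp (by fun_prop)
  fun_prop

theorem hasStrictFDerivAt_eval_perturb (p : κ → Fin 2 → ℝ) (i : κ) :
    HasStrictFDerivAt (fun w : (κ → ℝ) × (κ → Fin 2 → ℝ) => eval (w.2 i) (perturb f g w.1))
      (((evalDeriv f (p i)).comp (ContinuousLinearMap.snd ℝ _ _) + ∑ j, eval (p i) (g j) •
        (ContinuousLinearMap.proj (R := ℝ) (φ := fun _ : κ => ℝ) j).comp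
          (ContinuousLinearMap.fst ℝ _ _)).comp
        ((ContinuousLinearMap.fst ℝ (κ → ℝ) (κ → Fin 2 → ℝ)).prod
          ((ContinuousLinearMap.proj (R := ℝ) (φ := fun _ : κ => Fin 2 → ℝ) i).comp
            (ContinuousLinearMap.snd ℝ _ _)))) (0, p) := by
  simp only [eval_perturb]
  exact (hasStrictFDerivAt_family f g (p i)).comp (0, p)
    ((ContinuousLinearMap.fst ℝ (κ → ℝ) (κ → Fin 2 → ℝ)).prod
      ((ContinuousLinearMap.proj (R := ℝ) (φ := fun _ : κ => Fin 2 → ℝ) i).comp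
        (ContinuousLinearMap.snd ℝ _ _))).hasStrictFDerivAt

end

theorem eval_pderiv_pderiv_ne_zero {f : MvPolynomial (Fin 2) ℝ} {p : Fin 2 → ℝ}
    (hp : p ∈ extrema f) : eval p (pderiv 0 (pderiv 0 f)) ≠ 0 := by
  intro h
  have := hp.2
  rw [hess₂, map_sub, map_mul, map_mul, h, pderiv_comm 1 0] at this
  nlinarith [mul_self_nonneg (eval p (pderiv 0 (pderiv 1 f)))]

/-- If the critical values of `f` at a set of nondegenerate extrema can be moved
independently in a linear family, then `f` can be perturbed so that nearby extrema exist with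
arbitrarily prescribed values close to `0`. -/
theorem exists_perturb_critical_values {κ : Type*} [Fintype κ] [DecidableEq κ]
    {f : MvPolynomial (Fin 2) ℝ} {g : κ → MvPolynomial (Fin 2) ℝ} {p : κ → Fin 2 → ℝ}
    (hp : ∀ i, p i ∈ extrema f) (h0 : ∀ i, eval (p i) f = 0)
    (hg : ∀ i j, eval (p i) (g j) = if i = j then 1 else 0) (s : κ → ℝ)
    {N : Set ((κ → ℝ) × (κ → Fin 2 → ℝ))} (hN : N ∈ 𝓝 (0, p)) :
    ∃ ε > 0, ∃ w ∈ N, (∀ i, eval (w.2 i) (perturb f g w.1) = ε * s i) ∧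
      ∀ i k, eval (w.2 i) (pderiv k (perturb f g w.1)) = 0 := by
  have hΨ := (hasStrictFDerivAt_pi.2 (hasStrictFDerivAt_eval_perturb f g p)).prodMk
    (hasStrictFDerivAt_pi.2 fun i : κ => hasStrictFDerivAt_pi.2 fun k : Fin 2 =>
      hasStrictFDerivAt_eval_perturb (pderiv k f) (fun j => pderiv k (g j)) p i)
  -- Moving the points does not change the values to first order, since the gradients vanish; so the
  -- interpolation parameters prescribe the values, and the invertible Hessians then correct the
  -- gradients.
  have hmap := hΨ.map_nhds_eq_of_surj (by
    rw [LinearMap.range_eq_top]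
    rintro ⟨b, y⟩
    choose v hv using fun i => surjective_hessian (hp i).2.ne'
      (fun k => y i k - ∑ j, eval (p i) (pderiv k (g j)) * b j)
    have hz : ∀ i, evalDeriv f (p i) (v i) = 0 := fun i => by
      rw [evalDeriv_apply]
      exact Finset.sum_eq_zero fun k _ => by rw [(hp i).1, zero_mul]
    refine ⟨(b, v), Prod.ext (funext fun i => ?_) (funext fun i => funext fun k => ?_)⟩
    · simp [hz, hg]
    · simp [hv])
  have himg := Filter.image_mem_map (m := fun w : (κ → ℝ) × (κ → Fin 2 → ℝ) =>
    ((fun i => eval (w.2 i) (perturb f g w.1)),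
      fun i k => eval (w.2 i) (perturb (pderiv k f) (fun j => pderiv k (g j)) w.1))) hN
  erw [hmap] at himg
  have hpt : Filter.Tendsto (fun ε : ℝ => ((fun i => ε * s i), (0 : κ → Fin 2 → ℝ))) (𝓝 0)
      (𝓝 ((fun i => eval (p i) (perturb f g 0)),
        fun i k => eval (p i) (perturb (pderiv k f) (fun j => pderiv k (g j)) 0))) := by
    have : Continuous (fun ε : ℝ => ((fun i => ε * s i), (0 : κ → Fin 2 → ℝ))) := by fun_prop
    convert this.tendsto 0 using 2
    refine Prod.ext (funext fun i => ?_) (funext fun i => funext fun k => ?_)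
    · simp [perturb_zero, h0]
    · simp [perturb_zero, (hp i).1]
  obtain ⟨ε, hε, w, hw, he⟩ :=
    ((eventually_mem_nhdsWithin (a := (0 : ℝ)) (s := Set.Ioi 0)).and
      ((hpt.eventually himg).filter_mono nhdsWithin_le_nhds)).exists
  simp only [Prod.mk.injEq] at he
  refine ⟨ε, hε, w, hw, fun i => congrFun he.1 i, fun i k => ?_⟩
  rw [pderiv_perturb]
  exact congrFun (congrFun he.2 i) k

theorem exists_extrema_with_unit_values {κ : Type*} [Fintype κ] [DecidableEq κ] {d : ℕ}
    (hd : d ≠ 0) {f₀ : MvPolynomial (Fin 2) ℝ} (hf : f₀.totalDegree = d)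
    {g : κ → MvPolynomial (Fin 2) ℝ} (hgd : ∀ j, (g j).totalDegree < d)
    {p : κ → Fin 2 → ℝ} (hinj : Function.Injective p)
    (hp : ∀ i, p i ∈ extrema f₀) (h0 : ∀ i, eval (p i) f₀ = 0)
    (hg : ∀ i j, eval (p i) (g j) = if i = j then 1 else 0) :
    ∃ f : MvPolynomial (Fin 2) ℝ, f.totalDegree = d ∧ ∃ (q : κ → Fin 2 → ℝ) (s : κ → ℝ),
      Function.Injective q ∧ (∀ i, s i = 1 ∨ s i = -1) ∧ (∀ i, q i ∈ extrema f) ∧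
      (∀ i, eval (q i) f = s i) ∧ ∀ i, 0 < eval (q i) (pderiv 0 (pderiv 0 f)) * s i := by
  -- Minima are sent to level `1` and maxima to level `-1`, matching the maxima and minima of T_d so
  -- that `f` and -T_d bend the same way.
  have hs : ∀ i, ∃ s : ℝ, (s = 1 ∨ s = -1) ∧ 0 < eval (p i) (pderiv 0 (pderiv 0 f₀)) * s := by
    intro i
    rcases (eval_pderiv_pderiv_ne_zero (hp i)).lt_or_gt with h | h
    · exact ⟨-1, Or.inr rfl, by linarith⟩
    · exact ⟨1, Or.inl rfl, by linarith⟩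
  choose s hs1 hs2 using hs
  have hN : ∀ᶠ w : (κ → ℝ) × (κ → Fin 2 → ℝ) in 𝓝 (0, p),
      (∀ i j, i ≠ j → w.2 i ≠ w.2 j) ∧ (∀ i, 0 < eval (w.2 i) (hess₂ (perturb f₀ g w.1))) ∧
        ∀ i, 0 < eval (w.2 i) (pderiv 0 (pderiv 0 (perturb f₀ g w.1))) * s i := by
    refine (eventually_all.2 fun i => eventually_all.2 fun j => ?_).and
      ((eventually_all.2 fun i => ?_).and (eventually_all.2 fun i => ?_))
    · by_cases hij : i = j
      · exact Eventually.of_forall fun _ h => absurd hij h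
      · have h1 : Continuous fun w : (κ → ℝ) × (κ → Fin 2 → ℝ) => w.2 i := by fun_prop
        have h2 : Continuous fun w : (κ → ℝ) × (κ → Fin 2 → ℝ) => w.2 j := by fun_prop
        filter_upwards [(isOpen_ne_fun h1 h2).mem_nhds (x := (0, p)) (hinj.ne hij)] with w hw _
        exact hw
    · have hc : Continuous fun w : (κ → ℝ) × (κ → Fin 2 → ℝ) =>
          eval (w.2 i) (hess₂ (perturb f₀ g w.1)) := by
        simp only [hess₂, pderiv_perturb, map_sub, map_mul]
        exact ((continuous_eval_perturb _ _ i).mul (continuous_eval_perturb _ _ i)).sub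
          ((continuous_eval_perturb _ _ i).mul (continuous_eval_perturb _ _ i))
      refine (isOpen_Ioi.preimage hc).mem_nhds ?_
      simpa [perturb_zero] using (hp i).2
    · have hc : Continuous fun w : (κ → ℝ) × (κ → Fin 2 → ℝ) =>
          eval (w.2 i) (pderiv 0 (pderiv 0 (perturb f₀ g w.1))) * s i := by
        simp only [pderiv_perturb]
        exact (continuous_eval_perturb _ _ i).mul continuous_const
      refine (isOpen_Ioi.preimage hc).mem_nhds ?_
      simpa [perturb_zero] using hs2 i
  obtain ⟨ε, hε, ⟨a, q⟩, ⟨hq1, hq2, hq3⟩, hval, hcrit⟩ :=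
    exists_perturb_critical_values hp h0 hg s hN
  have hε' : 0 < ε⁻¹ := inv_pos.2 hε
  refine ⟨C ε⁻¹ * perturb f₀ g a, ?_, q, s, fun i j h => ?_, hs1, fun i => ⟨fun k => ?_, ?_⟩,
    fun i => ?_, fun i => ?_⟩
  · have hF := totalDegree_perturb _ _ hf hd hgd a
    rw [totalDegree_mul_of_isDomain (C_ne_zero.2 hε'.ne') fun h => hd (by rw [← hF, h]; rfl),
      totalDegree_C, zero_add, hF]
  · by_contra hij
    exact hq1 i j hij h
  · rw [pderiv_C_mul, map_mul, hcrit, mul_zero]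
  · have := hq2 i
    simp only [hess₂, pderiv_C_mul, map_sub, map_mul, eval_C] at this ⊢
    nlinarith [mul_pos (mul_pos hε' hε') this]
  · rw [map_mul, eval_C, hval]
    field_simp
  · have := mul_pos hε' (hq3 i)
    simp only [pderiv_C_mul, map_mul, eval_C]
    rw [mul_assoc]
    exact this

/-! ### Counting and asymptotics. -/

/-- With m = d-2 this is the number of nodes times the number ⌊(d-1)/2⌋ of Chebyshev critical points
used at each level. -/
theorem lowerBound_add_two (m : ℕ) :
    lowerBound (m + 2) = ((m * (m + 1) / 2 * ((m + 1) / 2) : ℕ) : ℝ) := by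
  obtain ⟨k, hk⟩ : ∃ k, m * (m + 1) = 2 * k := (Nat.even_mul_succ_self m).two_dvd
  have hk' : (m : ℝ) * (m + 1) = 2 * k := by exact_mod_cast hk
  rw [hk, Nat.mul_div_cancel_left _ two_pos, lowerBound]
  rcases Nat.even_or_odd' m with ⟨c, rfl | rfl⟩
  · rw [if_pos (by simp [parity_simps]), show (2 * c + 1) / 2 = c by omega]
    push_cast at hk' ⊢
    linear_combination (c / 2 : ℝ) * hk'
  · rw [if_neg (by simp [parity_simps]), show (2 * c + 1 + 1) / 2 = c + 1 by omega]
    push_cast at hk' ⊢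
    linear_combination ((c + 1) / 2 : ℝ) * hk'

/-- Surfaces obtained by Chmutov's method with many solitary points. -/
theorem exists_many_solitaryPoints {d : ℕ} (hd : 1 ≤ d) :
    ∃ f : MvPolynomial (Fin 2) ℝ, f.totalDegree = d ∧
      lowerBound d ≤ ((solitaryPoints (equation d f)).ncard : ℝ) := by
  rcases hd.eq_or_lt with rfl | hd
  · refine ⟨powerCurve 1, totalDegree_powerCurve 1, ?_⟩
    simp [lowerBound]
  obtain ⟨m, rfl⟩ : ∃ m, d = m + 2 := ⟨d - 2, by omega⟩
  have hd0 : m + 2 ≠ 0 := by omega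
  obtain ⟨t, hinj, him, hx, hy⟩ := exists_node_params m
  choose x hx using hx
  choose y hy using hy
  obtain ⟨g, hgd, hg⟩ := exists_interpolation hinj him hx hy
  have hnode := fun i => mem_extrema_powerCurve hd0 (him i) (hx i) (hy i)
  have hpinj : Function.Injective fun i => ![x i, y i] := by
    intro i j h
    have h1 : x i = x j := congrFun h 0
    have h2 : y i = y j := congrFun h 1
    have e1 := norm_eq_of_pow_eq hd0 (by rw [hx, hx, h1] : t i ^ (m + 2) = t j ^ (m + 2))
    have e2 := norm_eq_of_pow_eq hd0 (by rw [hy, hy, h2] :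
      (t i - 1) ^ (m + 2) = (t j - 1) ^ (m + 2))
    rcases eq_or_eq_conj_of_norm_eq e1 e2 with h | h
    · exact hinj h
    · have h3 := congrArg Complex.im h
      rw [Complex.conj_im] at h3
      linarith [him i, him j]
  obtain ⟨f, hf, q, s, hq, hs, hqe, hval, hsign⟩ := exists_extrema_with_unit_values hd0
    (totalDegree_powerCurve (m + 2)) (fun j => (hgd j).trans_lt (by omega)) hpinj
    (fun i => (hnode i).2) (fun i => (hnode i).1) hg
  refine ⟨f, hf, ?_⟩
  have hcard := card_mul_le_ncard_solitaryPoints hf.le hq hs hqe hval hsign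
  rw [lowerBound_add_two, Nat.cast_le, ← card_triangle m, Nat.mul_div_cancel _ two_pos]
  exact hcard

theorem bddAbove_solitaryCounts (d : ℕ) : BddAbove (solitaryCounts d) := by
  refine ⟨d * (d + 1) * d + 4, ?_⟩
  rintro _ ⟨f, hf, rfl⟩
  have := (solitaryPoints_finite_and_ncard_le hf.le).2
  omega

theorem isGreatest_muCh {d : ℕ} (hd : 1 ≤ d) : IsGreatest (solitaryCounts d) (muCh d) := by
  obtain ⟨f, hf, -⟩ := exists_many_solitaryPoints hd
  exact ⟨Nat.sSup_mem ⟨_, f, hf, rfl⟩ (bddAbove_solitaryCounts d),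
    fun _ hn => le_csSup (bddAbove_solitaryCounts d) hn⟩

theorem muCh_mul_four_le {d : ℕ} (hd : 1 ≤ d) : muCh d * 4 ≤ d * (d + 1) * d + 4 := by
  obtain ⟨f, hf, h⟩ := (isGreatest_muCh hd).1
  rw [h]
  exact (solitaryPoints_finite_and_ncard_le hf.le).2

theorem le_lowerBound {d : ℕ} (hd : 1 ≤ d) :
    (1 / 4 : ℝ) * (d : ℝ) ^ 3 - 2 * (d : ℝ) ^ 2 ≤ lowerBound d := by
  have : (1 : ℝ) ≤ d := by exact_mod_cast hd
  rw [lowerBound]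
  split_ifs <;> nlinarith

/-- A sequence between the two bounds is asymptotic to `d ^ 3 / 4`. -/
theorem isLittleO_of_bounds {u : ℕ → ℝ} (h1 : ∀ d, 1 ≤ d → lowerBound d ≤ u d)
    (h2 : ∀ d, 1 ≤ d → u d ≤ muCh d) :
    (fun d => u d - (1 / 4 : ℝ) * (d : ℝ) ^ 3) =o[atTop] fun d : ℕ => (d : ℝ) ^ 3 := by
  -- The lower bound loses at most 2d², and the upper bound exceeds d³/4 by d²/4 + 1; the constant
  -- `2` covers both.
  have hO : (fun d => u d - (1 / 4 : ℝ) * (d : ℝ) ^ 3) =O[atTop] fun d : ℕ => (d : ℝ) ^ 2 := by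
    refine IsBigO.of_bound 2 ?_
    filter_upwards [eventually_ge_atTop 1] with d hd
    have h3 : (muCh d : ℝ) * 4 ≤ d * (d + 1) * d + 4 := by exact_mod_cast muCh_mul_four_le hd
    have hd' : (1 : ℝ) ≤ d := by exact_mod_cast hd
    rw [Real.norm_eq_abs, Real.norm_of_nonneg (by positivity), abs_le]
    constructor
    · linarith [h1 d hd, le_lowerBound hd]
    · nlinarith [h2 d hd]
  refine hO.trans_isLittleO ?_
  exact (isLittleO_pow_pow_atTop_of_lt (𝕜 := ℝ) (by norm_num : 2 < 3)).comp_tendsto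
    tendsto_natCast_atTop_atTop

theorem isEquivalent_of_isLittleO {u : ℕ → ℝ}
    (h : (fun d => u d - (1 / 4 : ℝ) * (d : ℝ) ^ 3) =o[atTop] fun d : ℕ => (d : ℝ) ^ 3) :
    u ~[atTop] fun d : ℕ => (1 / 4 : ℝ) * (d : ℝ) ^ 3 :=
  (isLittleO_const_mul_right_iff (by norm_num)).2 h

end Chmutov
theorem mainTheorem7 :
    -- the maximum is well defined: all counts are finite and a largest one exists
    (∀ d : ℕ, 1 ≤ d →
      (∀ f : MvPolynomial (Fin 2) ℝ, f.totalDegree = d →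
        (Chmutov.solitaryPoints (Chmutov.equation d f)).Finite) ∧
      IsGreatest (Chmutov.solitaryCounts d) (Chmutov.muCh d)) ∧
    -- its asymptotic value
    ((fun d : ℕ => (Chmutov.muCh d : ℝ) - (1 / 4 : ℝ) * (d : ℝ) ^ 3)
      =o[atTop] fun d : ℕ => (d : ℝ) ^ 3) ∧
    -- surfaces with at least `lowerBound d` solitary points are asymptotically optimal
    (∃ f : ℕ → MvPolynomial (Fin 2) ℝ,
      (∀ d : ℕ, 1 ≤ d → (f d).totalDegree = d ∧
        Chmutov.lowerBound d ≤
          ((Chmutov.solitaryPoints (Chmutov.equation d (f d))).ncard : ℝ)) ∧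
      (fun d : ℕ => ((Chmutov.solitaryPoints (Chmutov.equation d (f d))).ncard : ℝ))
        ~[atTop] fun d : ℕ => (Chmutov.muCh d : ℝ)) := by
  choose! f hf using fun (d : ℕ) (hd : 1 ≤ d) => Chmutov.exists_many_solitaryPoints hd
  have hle : ∀ d, 1 ≤ d → ((Chmutov.solitaryPoints (Chmutov.equation d (f d))).ncard : ℝ) ≤
      Chmutov.muCh d := fun d hd => by
    exact_mod_cast (Chmutov.isGreatest_muCh hd).2 ⟨f d, (hf d hd).1, rfl⟩
  have hmu := Chmutov.isLittleO_of_bounds (fun d hd => (hf d hd).2.trans (hle d hd))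
    fun d _ => le_refl (Chmutov.muCh d : ℝ)
  refine ⟨fun d hd => ⟨fun g hg => (Chmutov.solitaryPoints_finite_and_ncard_le hg.le).1,
    Chmutov.isGreatest_muCh hd⟩, hmu, f, hf, ?_⟩
  exact (Chmutov.isEquivalent_of_isLittleO (Chmutov.isLittleO_of_bounds
    (fun d hd => (hf d hd).2) hle)).trans (Chmutov.isEquivalent_of_isLittleO hmu).symm
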